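/- **Ground state connectivity (GSCON).** An instance on $n$ qubits consists of a $k$-local Hamiltonian $H$ on $(\mathbb C^2)^{\otimes n}$ (a finite sum of Hermitian terms, each acting on at most $k$ qubits), real thresholds $\eta_1,\eta_2,\eta_3,\eta_4,\Delta$ with $\eta_3\ge 0$, $\eta_2-\eta_1\ge\Delta$ and $\eta_4-\eta_3\ge\Delta$, integers $l,m\ge 0$, and two quantum circuits over a finite gate set which on input $|0^n\rangle$ generate states $|\psi\rangle$ and $|\phi\rangle$ with $\langle\psi|H|\psi\rangle\le\eta_1$ and $\langle\phi|H|\phi\rangle\le\eta_1$. For a sequence $U_1,\dots,U_m$ of unitaries, each acting on at most $l$ qubits, put $|\psi_i\rangle=U_i\cdots U_1|\psi\rangle$. The instance is a YES-instance if some such sequence satisfies $\langle\psi_i|H|\psi_i\rangle\le\eta_1$ for all $1\le i\le m$ and $\||\psi_m\rangle-|\phi\rangle\|\le\eta_3$. It is a NO-instance if every such sequence satisfies $\langle\psi_i|H|\psi_i\rangle\ge\eta_2$ for some $1\le i\le m$, or $\||\psi_m\rangle-|\phi\rangle\|\ge\eta_4$. **Corollary.** For every polynomial $q$ there is a polynomial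 $p$ (both with coefficients in $\mathbb N$) such that for every subexponential gap function $\delta(n)=2^{-o(n)}$ the following hold. 1. There is an $n_0$ such that for all $n\ge n_0$ no GSCON instance on $n$ qubits with $l=2$, spectral norm $\|H\|\le 2^{q(n)}$, $\Delta\ge\delta(n)$ and $m\ge 2^{p(n)}$ is a NO-instance. 2. This regime of GSCON is in P: for every finite gate set and all polynomials $s,r$, consider the promise problem of distinguishing the YES-instances from the NO-instances among the instances with $l=2$, $\|H\|\le 2^{q(n)}$, $\Delta\ge\delta(n)$ and $2^{p(n)}\le m\le 2^{r(n)}$ for which $H$ is given by a list of $k$-local Hermitian terms with complex rational entries, all numeric parameters are rational, and the description (apart from $m$) has size at most $s(n)$, where the size counts the binary digits of $k$, of the thresholds and of the entries of the terms, the number of terms, and the number of gates of the two circuits. Under every encoding of the finite descriptions by strings over a finite alphabet, this promise problem is decided by a polynomial-time Turing machine. -/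

import Mathlib

open Filter Asymptotics

noncomputable section

namespace GSCON

/-- Labels of the computational basis states of `n` qubits. -/
abbrev Bits (n : ℕ) : Type := Fin n → Bool

/-- The Hilbert space `(ℂ²)^{⊗ n}` of `n` qubits. -/
abbrev Qubits (n : ℕ) : Type := EuclideanSpace ℂ (Bits n)

/-- Operators on `n` qubits, as matrices in the computational basis. -/
abbrev Op (n : ℕ) : Type := Matrix (Bits n) (Bits n) ℂ

/-- The state `|0^n⟩`. -/
def zeroState (n : ℕ) : Qubits n := EuclideanSpace.single (fun _ => false) 1

/-- The operator on `n` qubits that acts as `B` on the `j` distinct qubits `w 0, …, w (j - 1)`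
and as the identity on all others. -/
def embed {j n : ℕ} (w : Fin j ↪ Fin n) (B : Op j) : Op n :=
  open Classical in
  Matrix.of fun x y => if ∀ i, i ∉ Set.range w → x i = y i then B (x ∘ w) (y ∘ w) else 0

/-- `A` acts nontrivially on at most `l` qubits. -/
def IsLocal {n : ℕ} (l : ℕ) (A : Op n) : Prop :=
  ∃ j ≤ l, ∃ (w : Fin j ↪ Fin n) (B : Op j), A = embed w B

/-- A `k`-local Hamiltonian: a finite sum of Hermitian terms, each acting on at most `k` qubits. -/
def IsLocalHamiltonian {n : ℕ} (k : ℕ) (H : Op n) : Prop :=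
  ∃ terms : List (Op n), (∀ h ∈ terms, h.IsHermitian ∧ IsLocal k h) ∧ H = terms.sum

/-- The spectral norm of an operator. -/
def specNorm {n : ℕ} (A : Op n) : ℝ := ‖Matrix.toEuclideanCLM (𝕜 := ℂ) A‖

/-- The energy `⟨v| H |v⟩` (a real number for Hermitian `H`). -/
def energy {n : ℕ} (H : Op n) (v : Qubits n) : ℝ :=
  (inner ℂ v (Matrix.toEuclideanLin H v)).re

/-- Apply the operators of a list to `v`, the head of the list first. -/
def run {n : ℕ} (Us : List (Op n)) (v : Qubits n) : Qubits n :=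
  Us.foldl (fun u U => Matrix.toEuclideanLin U u) v

/-- A finite set of quantum gates, gate `g` acting on `arity g` qubits. -/
structure GateSet where
  card : ℕ
  arity : Fin card → ℕ
  gate : (g : Fin card) → Op (arity g)
  unitary : ∀ g, gate g ∈ Matrix.unitaryGroup (Bits (arity g)) ℂ

/-- A gate of the gate set together with the distinct qubits it is applied to. -/
structure PlacedGate (G : GateSet) (n : ℕ) where
  gate : Fin G.card
  wires : Fin (G.arity gate) ↪ Fin n

/-- The unitary on `n` qubits implemented by a placed gate. -/
def PlacedGate.op {G : GateSet} {n : ℕ} (g : PlacedGate G n) : Op n :=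
  embed g.wires (G.gate g.gate)

/-- A quantum circuit over the gate set `G`; the head of the list is applied first. -/
abbrev Circuit (G : GateSet) (n : ℕ) : Type := List (PlacedGate G n)

/-- The state that a circuit generates on input `|0^n⟩`. -/
def Circuit.state {G : GateSet} {n : ℕ} (C : Circuit G n) : Qubits n :=
  run (C.map PlacedGate.op) (zeroState n)

/-- The data `(H, k, η₁, η₂, η₃, η₄, Δ, l, m, U_ψ, U_φ)` of an instance of ground state
connectivity on `n` qubits. -/
structure Instance (G : GateSet) (n : ℕ) where
  H : Op n
  k : ℕ
  η₁ : ℝ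
  η₂ : ℝ
  η₃ : ℝ
  η₄ : ℝ
  Δ : ℝ
  l : ℕ
  m : ℕ
  startCircuit : Circuit G n
  targetCircuit : Circuit G n

namespace Instance

variable {G : GateSet} {n : ℕ}

/-- The starting state `|ψ⟩`. -/
def ψ (x : Instance G n) : Qubits n := Circuit.state x.startCircuit

/-- The target state `|φ⟩`. -/
def φ (x : Instance G n) : Qubits n := Circuit.state x.targetCircuit

/-- The requirements on the input. The threshold `η₃` bounds a distance, so it is nonnegative. -/
structure Valid (x : Instance G n) : Prop where
  local_hamiltonian : IsLocalHamiltonian x.k x.H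
  energy_gap : x.Δ ≤ x.η₂ - x.η₁
  distance_gap : x.Δ ≤ x.η₄ - x.η₃
  distance_nonneg : 0 ≤ x.η₃
  energy_start : energy x.H x.ψ ≤ x.η₁
  energy_target : energy x.H x.φ ≤ x.η₁

/-- `Us = [U₁, …, U_m]` is a sequence of `m` unitaries, each `l`-local. -/
def IsSequence (x : Instance G n) (Us : List (Op n)) : Prop :=
  Us.length = x.m ∧ ∀ U ∈ Us, U ∈ Matrix.unitaryGroup (Bits n) ℂ ∧ IsLocal x.l U

/-- The intermediate state `U_i ⋯ U_1 |ψ⟩`. -/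
def intermediate (x : Instance G n) (Us : List (Op n)) (i : ℕ) : Qubits n :=
  run (Us.take i) x.ψ

/-- The condition for YES-instances. -/
def IsYes (x : Instance G n) : Prop :=
  ∃ Us, x.IsSequence Us ∧
    (∀ i ∈ Finset.Icc 1 x.m, energy x.H (x.intermediate Us i) ≤ x.η₁) ∧
    ‖x.intermediate Us x.m - x.φ‖ ≤ x.η₃

/-- The condition for NO-instances. -/
def IsNo (x : Instance G n) : Prop :=
  ∀ Us, x.IsSequence Us →
    (∃ i ∈ Finset.Icc 1 x.m, x.η₂ ≤ energy x.H (x.intermediate Us i)) ∨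
    x.η₄ ≤ ‖x.intermediate Us x.m - x.φ‖

end Instance

/-- `δ(n) = 2^{-o(n)}`. -/
def Subexponential (δ : ℕ → ℝ) : Prop :=
  ∃ f : ℕ → ℝ, f =o[atTop] (fun n => (n : ℝ)) ∧ ∀ n, δ n = (2 : ℝ) ^ (-f n)

/-! ### Finite descriptions of instances and the promise problem -/

/-- The number of binary digits in a fraction. -/
def ratSize (q : ℚ) : ℕ := q.num.natAbs.size + q.den.size

/-- A local term with complex rational entries, each given by its real and imaginary part. -/
structure Term (n : ℕ) where
  arity : ℕ
  wires : Fin arity ↪ Fin n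
  entries : Matrix (Bits arity) (Bits arity) (ℚ × ℚ)

namespace Term

variable {n : ℕ}

/-- The matrix of a term on the qubits it acts on. -/
def matrix (t : Term n) : Op t.arity := t.entries.map fun z => ⟨(z.1 : ℝ), (z.2 : ℝ)⟩

/-- The number of binary digits in the entries of a term. -/
def size (t : Term n) : ℕ :=
  ∑ a, ∑ b, (ratSize (t.entries a b).1 + ratSize (t.entries a b).2)

end Term

/-- A finite description of an instance: the Hamiltonian is given by the list of its terms, and
all numeric parameters are rational. -/
structure Input (G : GateSet) where
  n : ℕ
  terms : List (Term n)
  k : ℕ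
  η₁ : ℚ
  η₂ : ℚ
  η₃ : ℚ
  η₄ : ℚ
  Δ : ℚ
  l : ℕ
  m : ℕ
  startCircuit : Circuit G n
  targetCircuit : Circuit G n

namespace Input

variable {G : GateSet}

/-- The instance that is described. -/
def toInstance (x : Input G) : Instance G x.n where
  H := (x.terms.map fun t => embed t.wires t.matrix).sum
  k := x.k
  η₁ := x.η₁
  η₂ := x.η₂
  η₃ := x.η₃
  η₄ := x.η₄
  Δ := x.Δ
  l := x.l
  m := x.m
  startCircuit := x.startCircuit
  targetCircuit := x.targetCircuit

/-- The listed terms are Hermitian and `k`-local, and the instance is valid. -/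
def Valid (x : Input G) : Prop :=
  (∀ t ∈ x.terms, t.arity ≤ x.k ∧ t.matrix.IsHermitian) ∧ x.toInstance.Valid

/-- The size of the description, apart from `m`: the number of binary digits of the locality and
of the numeric parameters, the number of terms and the digits of their entries, and the number of
gates of the two circuits. -/
def size (x : Input G) : ℕ :=
  x.k.size + ratSize x.η₁ + ratSize x.η₂ + ratSize x.η₃ + ratSize x.η₄ + ratSize x.Δ +
    (x.terms.map fun t => 1 + t.size).sum + x.startCircuit.length + x.targetCircuit.length

/-- The inputs of the restricted problem: valid inputs with `2`-local gates, a description of size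
at most `s(n)`, a Hamiltonian of norm at most `2^{q(n)}`, gap at least `δ(n)`, and
`2^{p(n)} ≤ m ≤ 2^{r(n)}`. -/
structure InRegime (x : Input G) (s q p r : Polynomial ℕ) (δ : ℕ → ℝ) : Prop where
  valid : x.Valid
  two_local : x.l = 2
  size_le : x.size ≤ s.eval x.n
  norm_le : specNorm x.toInstance.H ≤ (2 : ℝ) ^ q.eval x.n
  gap_ge : δ x.n ≤ x.Δ
  le_length : 2 ^ p.eval x.n ≤ x.m
  length_le : x.m ≤ 2 ^ r.eval x.n

end Input

/-- The promise problem with YES-strings `yes` and NO-strings `no` is in P: some function that a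
Turing machine computes in polynomial time is `true` on all of `yes` and `false` on all
of `no`. -/
def PromiseInP {Γ : Type} (yes no : Set (List Γ)) : Prop :=
  ∃ f : List Γ → Bool,
    Nonempty (Turing.TM2ComputableInPolyTime (id : List Γ → List Γ) Computability.encodeBool f) ∧
      (∀ w ∈ yes, f w = true) ∧ ∀ w ∈ no, f w = false

end GSCON

end

/-!
The energy thresholds leave a slack `Δ ≥ 2 ^ (-n)`, so it suffices to show that any two states of
energy at most `η₁` are joined, up to a distance below `2 ^ (-n)`, by at most `2 ^ p(n)` two-local
unitaries whose intermediate states have energy below `η₁ + 2 ^ (-n)`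
(`GSCON.exists_connects_low_energy`). Then there are no NO-instances on `n ≥ n₀` qubits. For smaller
`n` the bounds on the description leave finitely many inputs, so the NO-strings form a finite
language; a Turing machine that simulates a finite automaton rejects exactly these.

*The path.* After multiplying the target by a suitable phase, its overlap with the start is real and
the cross term of the quadratic form `⟨v|H|v⟩ - η₁ ‖v‖²` is nonpositive
(`GSCON.exists_good_phase`). On the great circle arc between the two states this form is then
nonpositive, so the energy never exceeds `η₁` (`GSCON.energy_arc_le`). A final global phase, which
is a single gate, leads to the target. Neither locality nor Hermiticity of `H` plays a role here;
only the norm of `H` matters, to bound the energy of states near the arc.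

*Following the path.* The rotation along the arc is generated by `i M` with `M` Hermitian. The
projectors onto the `4 ^ n` product states of four fixed one-qubit states span the operators on `n`
qubits, so `M` is a real combination of them with coefficients of size `2 ^ O(n)`
(`GSCON.exists_stateProj_decomposition`). A first-order product formula follows the arc in `T` steps
with total error `2 ^ O(n) / T`, by factors `exp (i θ P)` with `P` such a projector and
`|θ| ≤ 2 ^ O(n) / T` (`GSCON.exists_connects_arc_step`).

*Implementing the factors.* Every gate has to be close to the identity, for otherwise the energy
could rise inside a factor. The phase `exp (i θ P)` is a product of multiply controlled one-qubit
rotations (`GSCON.phase_insert`). The commutator of `C_S(a)` and `C_T(b)`, one-qubit operations on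
a common target controlled by sets `S` and `T`, is exactly `C_{S ∪ T}([a, b])`
(`GSCON.controlled_commutator`), and every unit quaternion at distance `σ²` from `1` is a
commutator of unit quaternions at distance `O(σ)` (`GSCON.exists_commutator`). Halving the set of
controls `log n` times therefore expresses a rotation at distance `r ^ O(n)` from the identity by
polynomially many two-qubit gates at distance `r` (`GSCON.isWord_controlled`). With `r` and `1 / T`
exponentially small with polynomial exponents, all errors are below `2 ^ (-n)`, and the number of
gates is `2 ^ poly(n)`.
-/

namespace GSCON

/-! ### Deciding a regular language by a Turing machine -/

theorem isRegular_of_finite {Γ : Type} {L : Language Γ} (h : Set.Finite (L : Set (List Γ))) :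
    L.IsRegular := by
  apply Language.IsRegular.of_finite_range_leftQuotient
  have hs : Set.Finite {y : List Γ | ∃ w ∈ (L : Set (List Γ)), y ∈ w.tails} := by
    have := h.biUnion (t := fun w => {y : List Γ | y ∈ w.tails}) fun w _ => List.finite_toSet _
    refine this.subset ?_
    rintro y ⟨w, hw, hy⟩
    exact Set.mem_biUnion hw hy
  refine hs.finite_subsets.subset ?_
  rintro _ ⟨x, rfl⟩ y hy
  exact ⟨x ++ y, hy, by simp⟩

/-- The Turing machine that runs a deterministic finite automaton on its input. The flag in the
machine state records whether the input has been exhausted. -/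
def dfaMachine {Γ σ : Type} [Fintype Γ] [Fintype σ] (M : DFA Γ σ) (acc : σ → Bool) :
    Turing.FinTM2 where
  K := Bool
  k₀ := false
  k₁ := true
  Γ := fun k => if k then Bool else Γ
  Λ := Unit
  main := ()
  σ := σ × Bool
  initialState := (M.start, false)
  Γk₀Fin := inferInstanceAs (Fintype Γ)
  m := fun _ => .pop false
    (fun v o => match (o : Option Γ) with
      | none => (v.1, true)
      | some a => (M.step v.1 a, false))
    (.branch (fun v => v.2)
      (.push true (fun v => acc v.1) (.load (fun _ => (M.start, false)) .halt))
      (.goto fun _ => ()))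

/-- The configuration of `dfaMachine` in automaton state `v` with `w` left to be read. -/
def dfaCfg {Γ σ : Type} [Fintype Γ] [Fintype σ] (M : DFA Γ σ) (acc : σ → Bool) (v : σ)
    (w : List Γ) : (dfaMachine M acc).Cfg where
  l := some ()
  var := (v, false)
  stk := fun k => match k with
    | false => w
    | true => ([] : List Bool)

theorem dfaMachine_run {Γ σ : Type} [Fintype Γ] [Fintype σ] (M : DFA Γ σ) (acc : σ → Bool)
    (w : List Γ) (v : σ) :
    (flip Bind.bind (dfaMachine M acc).step)^[w.length + 1] (some (dfaCfg M acc v w)) =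
      some (Turing.haltList (dfaMachine M acc) [acc (M.evalFrom v w)]) := by
  induction w generalizing v with
  | nil =>
    change some _ = some _
    congr 1
    simp only [Turing.TM2.stepAux, dfaMachine, Turing.haltList]
    change Turing.TM2.Cfg.mk _ _ _ = Turing.TM2.Cfg.mk _ _ _
    congr 1
    funext k
    cases k
    · rfl
    · rfl
  | cons a w ih =>
    rw [List.length_cons, Function.iterate_succ_apply, DFA.evalFrom_cons, ← ih]
    congr 1
    change some _ = some _
    congr 1
    change Turing.TM2.Cfg.mk _ _ _ = Turing.TM2.Cfg.mk _ _ _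
    congr 1
    funext k
    cases k
    · rfl
    · rfl

/-- Membership in a regular language is decided by a Turing machine in linear time. -/
theorem nonempty_polyTime_of_isRegular {Γ : Type} [Fintype Γ] {L : Language Γ}
    (h : L.IsRegular) (f : List Γ → Bool) (hf : ∀ w, f w = true ↔ w ∈ L) :
    Nonempty (Turing.TM2ComputableInPolyTime (id : List Γ → List Γ) Computability.encodeBool f) := by
  classical
  obtain ⟨σ, _, M, rfl⟩ := h
  refine ⟨{
    tm := dfaMachine M fun v => decide (v ∈ M.accept)
    inputAlphabet := Equiv.refl Γ
    outputAlphabet := Equiv.refl Bool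
    time := Polynomial.X + 1
    outputsFun := fun w => ⟨⟨w.length + 1, ?_⟩, by simp⟩ }⟩
  have h1 : decide (M.evalFrom M.start w ∈ M.accept) = f w := by
    rw [Bool.eq_iff_iff, hf w, decide_eq_true_iff]
    rfl
  have h2 : Turing.initList (dfaMachine M fun v => decide (v ∈ M.accept)) w =
      dfaCfg M (fun v => decide (v ∈ M.accept)) M.start w := by
    change Turing.TM2.Cfg.mk _ _ _ = Turing.TM2.Cfg.mk _ _ _
    congr 1
    funext k
    cases k
    · rfl
    · rfl
  have h3 := dfaMachine_run M (fun v => decide (v ∈ M.accept)) w M.start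
  rw [h1, ← h2] at h3
  have h4 : List.map (Equiv.refl Γ).invFun (id w) = w := List.map_id w
  have h5 : List.map (Equiv.refl Bool).invFun (Computability.encodeBool (f w)) = [f w] := rfl
  erw [h4, h5]
  exact h3

/-- Only the finitely many NO-strings have to be recognised, since every other string may be
accepted. -/
theorem promiseInP_of_finite {Γ : Type} [Fintype Γ] {yes no : Set (List Γ)} (hno : no.Finite)
    (hdisj : Disjoint yes no) : PromiseInP yes no := by
  classical
  refine ⟨fun w => decide (w ∉ no), ?_, ?_, ?_⟩
  · have h : Language.IsRegular (T := Γ) (no : Set (List Γ)) := isRegular_of_finite hno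
    refine nonempty_polyTime_of_isRegular h.compl _ fun w => ?_
    rw [decide_eq_true_iff]
    rfl
  · intro w hw
    simpa using Set.disjoint_left.1 hdisj hw
  · intro w hw
    simpa using hw

/-! ### Inputs of bounded size -/

theorem finite_ratSize_le (B : ℕ) : {q : ℚ | ratSize q ≤ B}.Finite := by
  have hfin : ((Set.Icc (-(2 : ℤ) ^ B) (2 ^ B)) ×ˢ (Set.Iic (2 ^ B : ℕ))).Finite :=
    (Set.finite_Icc _ _).prod (Set.finite_Iic _)
  refine Set.Finite.of_finite_image (f := fun q : ℚ => (q.num, q.den)) (hfin.subset ?_) ?_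
  · rintro _ ⟨q, hq, rfl⟩
    have hq : q.num.natAbs.size + q.den.size ≤ B := hq
    have h1 : q.num.natAbs < 2 ^ B := Nat.size_le.1 (by omega)
    have h2 : q.den < 2 ^ B := Nat.size_le.1 (by omega)
    have h3 : ((q.num.natAbs : ℕ) : ℤ) < 2 ^ B := by exact_mod_cast h1
    simp only [Set.mem_prod, Set.mem_Icc, Set.mem_Iic]
    omega
  · intro a _ b _ hab
    simp only [Prod.mk.injEq] at hab
    exact Rat.ext hab.1 hab.2

theorem finite_nat_size_le (B : ℕ) : {k : ℕ | k.size ≤ B}.Finite :=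
  (Set.finite_Iio (2 ^ B)).subset fun _ hk => Nat.size_le.1 hk

theorem finite_term_size_le (n B : ℕ) : {t : Term n | t.size ≤ B}.Finite := by
  have hQ : {q : ℚ | ratSize q ≤ B}.Finite := finite_ratSize_le B
  have hfin : (⋃ j ∈ Set.Iic n, ⋃ w ∈ (Set.univ : Set (Fin j ↪ Fin n)),
      (fun E => Term.mk j w E) '' Set.pi Set.univ fun _ => Set.pi Set.univ fun _ =>
        {q : ℚ | ratSize q ≤ B} ×ˢ {q : ℚ | ratSize q ≤ B}).Finite :=
    (Set.finite_Iic n).biUnion fun j _ => Set.finite_univ.biUnion fun w _ =>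
      (Set.Finite.pi fun _ => Set.Finite.pi fun _ => hQ.prod hQ).image _
  refine hfin.subset ?_
  rintro ⟨j, w, E⟩ ht
  have hj : j ≤ n := by simpa using Fintype.card_le_of_embedding w
  simp only [Set.mem_iUnion]
  refine ⟨j, hj, w, trivial, E, ?_, rfl⟩
  intro a _ b _
  have ht : ∑ a, ∑ b, (ratSize (E a b).1 + ratSize (E a b).2) ≤ B := ht
  have h1 : ratSize (E a b).1 + ratSize (E a b).2 ≤
      ∑ b, (ratSize (E a b).1 + ratSize (E a b).2) :=
    Finset.single_le_sum (f := fun b => ratSize (E a b).1 + ratSize (E a b).2)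
      (fun _ _ => Nat.zero_le _) (Finset.mem_univ b)
  have h2 : ∑ b, (ratSize (E a b).1 + ratSize (E a b).2) ≤
      ∑ a, ∑ b, (ratSize (E a b).1 + ratSize (E a b).2) :=
    Finset.single_le_sum (f := fun a => ∑ b, (ratSize (E a b).1 + ratSize (E a b).2))
      (fun _ _ => Nat.zero_le _) (Finset.mem_univ a)
  exact ⟨show ratSize _ ≤ B by omega, show ratSize _ ≤ B by omega⟩

theorem finite_list_of_finite {α : Type*} {s : Set α} (hs : s.Finite) (B : ℕ) :
    {l : List α | l.length ≤ B ∧ ∀ a ∈ l, a ∈ s}.Finite := by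
  have := hs.to_subtype
  refine ((List.finite_length_le s B).image (List.map Subtype.val)).subset ?_
  rintro l ⟨hl, hls⟩
  exact ⟨l.attachWith _ hls, by simpa using hl, by simp⟩

instance finite_placedGate (G : GateSet) (n : ℕ) : Finite (PlacedGate G n) := by
  refine Finite.of_injective
    (fun g => (⟨g.gate, g.wires⟩ : Σ a : Fin G.card, Fin (G.arity a) ↪ Fin n)) ?_
  rintro ⟨g, w⟩ ⟨g', w'⟩ h
  simp only [Sigma.mk.injEq] at h
  obtain ⟨rfl, h⟩ := h
  simpa using h

theorem finite_input_size_le (G : GateSet) (N B M : ℕ) :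
    {x : Input G | x.n < N ∧ x.size ≤ B ∧ x.l = 2 ∧ x.m ≤ M}.Finite := by
  have hQ : {q : ℚ | ratSize q ≤ B}.Finite := finite_ratSize_le B
  have hfin : (⋃ n ∈ Set.Iio N, (fun y : List (Term n) × ℕ × ℚ × ℚ × ℚ × ℚ × ℚ × ℕ ×
        Circuit G n × Circuit G n => Input.mk n y.1 y.2.1 y.2.2.1 y.2.2.2.1 y.2.2.2.2.1
          y.2.2.2.2.2.1 y.2.2.2.2.2.2.1 2 y.2.2.2.2.2.2.2.1 y.2.2.2.2.2.2.2.2.1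
          y.2.2.2.2.2.2.2.2.2) ''
      ({l : List (Term n) | l.length ≤ B ∧ ∀ t ∈ l, t ∈ {t : Term n | t.size ≤ B}} ×ˢ
        {k : ℕ | k.size ≤ B} ×ˢ {q : ℚ | ratSize q ≤ B} ×ˢ {q : ℚ | ratSize q ≤ B} ×ˢ
        {q : ℚ | ratSize q ≤ B} ×ˢ {q : ℚ | ratSize q ≤ B} ×ˢ {q : ℚ | ratSize q ≤ B} ×ˢ
        Set.Iic M ×ˢ {C : Circuit G n | C.length ≤ B} ×ˢ {C : Circuit G n | C.length ≤ B})).Finite :=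
    (Set.finite_Iio N).biUnion fun n _ => Set.Finite.image _
      ((finite_list_of_finite (finite_term_size_le n B) B).prod <| (finite_nat_size_le B).prod <|
        hQ.prod <| hQ.prod <| hQ.prod <| hQ.prod <| hQ.prod <| (Set.finite_Iic M).prod <|
        (List.finite_length_le _ B).prod (List.finite_length_le _ B))
  refine hfin.subset ?_
  rintro ⟨n, terms, k, a, b, c, d, e, l, m, C, D⟩ ⟨hn, hs, hl, hm⟩
  simp only [Input.size] at hs hn hl hm
  subst hl
  have hterm : ∀ t ∈ terms, 1 + t.size ≤ (terms.map fun t => 1 + t.size).sum := fun t ht =>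
    List.single_le_sum (by simp) _ (List.mem_map.2 ⟨t, ht, rfl⟩)
  have hlen : terms.length ≤ (terms.map fun t => 1 + t.size).sum := by
    clear hterm hs
    induction terms with
    | nil => simp
    | cons t ts ih => simp only [List.length_cons, List.map_cons, List.sum_cons]; omega
  simp only [Set.mem_iUnion]
  refine ⟨n, hn, ⟨terms, k, a, b, c, d, e, m, C, D⟩, ?_, rfl⟩
  simp only [Set.mem_prod, Set.mem_ofPred_eq, Set.mem_Iic]
  refine ⟨⟨by omega, fun t ht => ?_⟩, by omega, by omega, by omega, by omega, by omega, by omega,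
    hm, by omega, by omega⟩
  have := hterm t ht
  omega

/-! ### Embedded operators and tensor products -/

section Embed

variable {j n : ℕ} (w : Fin j ↪ Fin n)

theorem embed_add (B C : Op j) : embed w (B + C) = embed w B + embed w C := by
  ext x y
  simp only [embed, Matrix.of_apply, Matrix.add_apply]
  split_ifs <;> simp

theorem embed_one : embed w (1 : Op j) = 1 := by
  ext x y
  simp only [embed, Matrix.of_apply, Matrix.one_apply]
  by_cases h : x = y
  · subst h; simp
  · rw [if_neg h]
    split_ifs with h1 h2
    · refine absurd (funext fun i => ?_) h
      by_cases hi : i ∈ Set.range w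
      · obtain ⟨a, rfl⟩ := hi
        exact congrFun h2 a
      · exact h1 i hi
    · rfl
    · rfl

theorem embed_conjTranspose (B : Op j) : (embed w B).conjTranspose = embed w B.conjTranspose := by
  ext x y
  simp only [embed, Matrix.of_apply, Matrix.conjTranspose_apply]
  have : (∀ i, i ∉ Set.range w → y i = x i) ↔ ∀ i, i ∉ Set.range w → x i = y i :=
    forall₂_congr fun _ _ => eq_comm
  simp only [this]
  split_ifs <;> simp

theorem embed_mul (B C : Op j) : embed w (B * C) = embed w B * embed w C := by
  classical
  ext x z
  simp only [embed, Matrix.of_apply, Matrix.mul_apply]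
  have hw := w.injective
  -- Only the labels that agree with `x` off the wires contribute.
  rw [← Fintype.sum_of_injective (fun b : Bits j => (Function.extend w b x : Bits n))
    (f := fun b : Bits j => if ∀ i, i ∉ Set.range w → x i = z i then
      B (x ∘ w) b * C b (z ∘ w) else 0)]
  · split_ifs with h
    · rfl
    · simp
  · intro b b' h
    funext a
    have := congrFun h (w a)
    simpa [hw.extend_apply] using this
  · intro y hy
    rw [if_neg, zero_mul]
    intro hxy
    refine hy ⟨y ∘ w, funext fun i => ?_⟩
    by_cases hi : i ∈ Set.range w
    · obtain ⟨a, rfl⟩ := hi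
      simp [hw.extend_apply]
    · simp only
      rw [Function.extend_apply' _ _ _ (by simpa using hi), hxy i hi]
  · intro b
    have h1 : ∀ i, i ∉ Set.range w → (Function.extend w b x : Bits n) i = x i := fun i hi =>
      Function.extend_apply' _ _ _ (by simpa using hi)
    have h2 : (Function.extend w b x : Bits n) ∘ w = b := funext fun a => hw.extend_apply _ _ _
    have h3 : (∀ i, i ∉ Set.range w → (Function.extend w b x : Bits n) i = z i) ↔
        ∀ i, i ∉ Set.range w → x i = z i := forall₂_congr fun i hi => by rw [h1 i hi]
    have h4 : ∀ i, i ∉ Set.range w → x i = (Function.extend w b x : Bits n) i :=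
      fun i hi => (h1 i hi).symm
    simp only [h2, h3, if_pos h4]
    split_ifs <;> simp

theorem embed_mem_unitaryGroup {B : Op j} (hB : B ∈ Matrix.unitaryGroup (Bits j) ℂ) :
    embed w B ∈ Matrix.unitaryGroup (Bits n) ℂ := by
  rw [Matrix.mem_unitaryGroup_iff] at hB ⊢
  rw [Matrix.star_eq_conjTranspose] at hB ⊢
  rw [embed_conjTranspose, ← embed_mul, hB, embed_one]

end Embed

/-- The tensor product of one-qubit operators. -/
def tensor {n : ℕ} (A : Fin n → Matrix Bool Bool ℂ) : Op n :=
  Matrix.of fun x y => ∏ i, A i (x i) (y i)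

section Tensor

variable {n : ℕ}

theorem tensor_apply (A : Fin n → Matrix Bool Bool ℂ) (x y : Bits n) :
    tensor A x y = ∏ i, A i (x i) (y i) := rfl

theorem tensor_mul (A B : Fin n → Matrix Bool Bool ℂ) :
    tensor A * tensor B = tensor fun i => A i * B i := by
  ext x z
  simp only [Matrix.mul_apply, tensor_apply, Fintype.prod_sum, Finset.prod_mul_distrib]

theorem tensor_one : tensor (fun _ : Fin n => (1 : Matrix Bool Bool ℂ)) = 1 := by
  ext x y
  simp only [tensor_apply, Matrix.one_apply]
  by_cases h : x = y
  · subst h; simp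
  · rw [if_neg h]
    obtain ⟨i, hi⟩ := Function.ne_iff.1 h
    exact Finset.prod_eq_zero (Finset.mem_univ i) (if_neg hi)

theorem tensor_conjTranspose (A : Fin n → Matrix Bool Bool ℂ) :
    (tensor A).conjTranspose = tensor fun i => (A i).conjTranspose := by
  ext x y
  simp [tensor_apply, Matrix.conjTranspose_apply]

/-- A tensor product whose factors off a set `F` of qubits are trivial acts on `F` only. -/
theorem tensor_eq_embed (A : Fin n → Matrix Bool Bool ℂ) (F : Finset (Fin n))
    (hA : ∀ i ∉ F, A i = 1) :
    tensor A = embed (F.orderEmbOfFin rfl).toEmbedding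
      (tensor fun i => A (F.orderEmbOfFin rfl i)) := by
  have hr : ∀ i, i ∉ Set.range (F.orderEmbOfFin rfl).toEmbedding ↔ i ∉ F := fun i => by
    simp
  ext x y
  simp only [embed, Matrix.of_apply, tensor_apply, hr]
  split_ifs with h
  · symm
    refine Fintype.prod_of_injective _ (F.orderEmbOfFin rfl).injective _ _ (fun i hi => ?_)
      fun i => rfl
    have hi : i ∉ F := (hr i).1 hi
    rw [hA i hi, h i hi, Matrix.one_apply_eq]
  · push Not at h
    obtain ⟨i, hi, hxy⟩ := h
    refine Finset.prod_eq_zero (Finset.mem_univ i) ?_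
    rw [hA i hi, Matrix.one_apply_ne hxy]

end Tensor

/-! ### Controlled one-qubit operators -/

/-- The operator acting as `X` on qubit `t`, as `Q i` on the other qubits `i ∈ S`, and trivially
elsewhere; it is additive in `X`. -/
def controlled {n : ℕ} (Q : Fin n → Matrix Bool Bool ℂ) (S : Finset (Fin n)) (t : Fin n) :
    Matrix Bool Bool ℂ →+ Op n where
  toFun X := tensor fun i => if i = t then X else if i ∈ S then Q i else 1
  map_zero' := by
    ext x y
    exact Finset.prod_eq_zero (Finset.mem_univ t) (by simp)
  map_add' X Y := by
    ext x y
    simp only [Matrix.add_apply, tensor_apply]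
    simp only [← Finset.mul_prod_erase _ _ (Finset.mem_univ t), if_true, Matrix.add_apply, add_mul]
    congr 2 <;>
    · refine Finset.prod_congr rfl fun i hi => ?_
      rw [if_neg (Finset.ne_of_mem_erase hi), if_neg (Finset.ne_of_mem_erase hi)]

section Controlled

variable {n : ℕ} {Q : Fin n → Matrix Bool Bool ℂ} {S T : Finset (Fin n)} {t : Fin n}

theorem controlled_apply (X : Matrix Bool Bool ℂ) :
    controlled Q S t X = tensor fun i => if i = t then X else if i ∈ S then Q i else 1 := rfl

theorem controlled_smul (c : ℂ) (X : Matrix Bool Bool ℂ) :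
    controlled Q S t (c • X) = c • controlled Q S t X := by
  ext x y
  simp only [Matrix.smul_apply, controlled_apply, tensor_apply]
  simp only [← Finset.mul_prod_erase _ _ (Finset.mem_univ t), if_true, Matrix.smul_apply,
    smul_eq_mul, mul_assoc]
  congr 2
  refine Finset.prod_congr rfl fun i hi => ?_
  rw [if_neg (Finset.ne_of_mem_erase hi), if_neg (Finset.ne_of_mem_erase hi)]

theorem controlled_mul (hQ : ∀ i, Q i * Q i = Q i) (X Y : Matrix Bool Bool ℂ) :
    controlled Q S t X * controlled Q T t Y = controlled Q (S ∪ T) t (X * Y) := by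
  simp only [controlled_apply, tensor_mul]
  congr 1
  funext i
  by_cases h : i = t
  · simp [h]
  · by_cases h1 : i ∈ S <;> by_cases h2 : i ∈ T <;> simp [h, h1, h2, hQ]

theorem controlled_conjTranspose (hQ : ∀ i, (Q i).conjTranspose = Q i) (X : Matrix Bool Bool ℂ) :
    (controlled Q S t X).conjTranspose = controlled Q S t X.conjTranspose := by
  simp only [controlled_apply, tensor_conjTranspose]
  congr 1
  funext i
  by_cases h : i = t
  · simp [h]
  · by_cases h1 : i ∈ S <;> simp [h, h1, hQ]

theorem norm_controlled_apply_le (hQ : ∀ i a b, ‖Q i a b‖ ≤ 1) {r : ℝ}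
    {X : Matrix Bool Bool ℂ} (hX : ∀ a b, ‖X a b‖ ≤ r) (x y : Bits n) :
    ‖controlled Q S t X x y‖ ≤ r := by
  rw [controlled_apply, tensor_apply, norm_prod, ← Finset.mul_prod_erase _ _ (Finset.mem_univ t),
    if_pos rfl]
  refine (mul_le_of_le_one_right (norm_nonneg _) (Finset.prod_le_one (fun _ _ => norm_nonneg _)
    fun i hi => ?_)).trans (hX _ _)
  rw [if_neg (Finset.ne_of_mem_erase hi)]
  split_ifs
  · exact hQ _ _ _
  · rw [Matrix.one_apply]; split_ifs <;> simp

/-- The commutator of two controlled operations on the same target is the commutator of the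
operations, controlled by both sets of control qubits: if either control is off, then the
product telescopes. -/
theorem controlled_commutator (hQ : ∀ i, Q i * Q i = Q i) {a b a' b' : Matrix Bool Bool ℂ}
    (ha : a * a' = 1) (hb : b * b' = 1) :
    (1 + controlled Q S t (a - 1)) * (1 + controlled Q T t (b - 1)) *
      (1 + controlled Q S t (a' - 1)) * (1 + controlled Q T t (b' - 1)) =
    1 + controlled Q (S ∪ T) t (a * b * a' * b' - 1) := by
  obtain ⟨α, rfl⟩ : ∃ α, a = 1 + α := ⟨a - 1, by abel⟩
  obtain ⟨β, rfl⟩ : ∃ β, b = 1 + β := ⟨b - 1, by abel⟩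
  obtain ⟨α', rfl⟩ : ∃ α, a' = 1 + α := ⟨a' - 1, by abel⟩
  obtain ⟨β', rfl⟩ : ∃ β, b' = 1 + β := ⟨b' - 1, by abel⟩
  have hα : α + α' + α * α' = 0 := by
    have : (1 + α) * (1 + α') - 1 = 0 := by rw [ha, sub_self]
    rw [← this]; noncomm_ring
  have hβ : β + β' + β * β' = 0 := by
    have : (1 + β) * (1 + β') - 1 = 0 := by rw [hb, sub_self]
    rw [← this]; noncomm_ring
  have hTS : T ∪ S = S ∪ T := Finset.union_comm _ _
  have h1 : S ∪ T ∪ S = S ∪ T := by grind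
  have h2 : S ∪ T ∪ T = S ∪ T := by grind
  have key : (1 + controlled Q S t α) * (1 + controlled Q T t β) *
      (1 + controlled Q S t α') * (1 + controlled Q T t β') =
    1 + controlled Q (S ∪ T) t ((1 + α) * (1 + β) * (1 + α') * (1 + β') - 1) +
      (controlled Q S t (α + α' + α * α') + controlled Q T t (β + β' + β * β')
        - controlled Q (S ∪ T) t (α + α' + α * α')
        - controlled Q (S ∪ T) t (β + β' + β * β')) := by
    simp only [mul_add, add_mul, mul_one, one_mul, controlled_mul hQ, hTS, h1, h2,
      map_add, map_sub, Finset.union_self]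
    abel
  simp only [add_sub_cancel_left]
  rw [key, hα, hβ]
  simp

theorem controlled_mem_unitaryGroup (hQ : ∀ i, Q i * Q i = Q i)
    (hQ' : ∀ i, (Q i).conjTranspose = Q i) {a : Matrix Bool Bool ℂ}
    (ha : a * a.conjTranspose = 1) :
    1 + controlled Q S t (a - 1) ∈ Matrix.unitaryGroup (Bits n) ℂ := by
  rw [Matrix.mem_unitaryGroup_iff, Matrix.star_eq_conjTranspose, Matrix.conjTranspose_add,
    controlled_conjTranspose hQ', Matrix.conjTranspose_sub, Matrix.conjTranspose_one,
    Matrix.conjTranspose_one]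
  have h : (a - 1) + (a.conjTranspose - 1) + (a - 1) * (a.conjTranspose - 1) = 0 := by
    have : a * a.conjTranspose - 1 = 0 := by rw [ha, sub_self]
    rw [← this]; noncomm_ring
  simp only [mul_add, add_mul, mul_one, one_mul, controlled_mul hQ, Finset.union_self]
  have h' := congrArg (controlled Q S t) h
  simp only [map_add, map_zero] at h'
  rw [add_assoc, ← add_assoc (controlled Q S t (a - 1)), h', add_zero]

theorem isLocal_controlled (ht : t ∉ S) (X : Matrix Bool Bool ℂ) :
    IsLocal (S.card + 1) (1 + controlled Q S t X) := by
  refine ⟨(insert t S).card, (Finset.card_insert_of_notMem ht).le,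
    ((insert t S).orderEmbOfFin rfl).toEmbedding, 1 + tensor fun a =>
      (fun i => if i = t then X else if i ∈ S then Q i else 1)
        ((insert t S).orderEmbOfFin rfl a), ?_⟩
  rw [embed_add, embed_one, controlled_apply]
  congr 1
  refine tensor_eq_embed _ (insert t S) fun i hi => ?_
  simp only [Finset.mem_insert, not_or] at hi
  rw [if_neg hi.1, if_neg hi.2]

end Controlled

open scoped Quaternion
/-! ### Unit quaternions as one-qubit gates -/

/-- The representation of the quaternions by complex `2 × 2` matrices. Unit quaternions become
the matrices in `SU(2)`. -/
def quatMatrix : ℍ[ℝ] →+* Matrix Bool Bool ℂ where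
  toFun q := Matrix.of fun a b => match a, b with
    | false, false => ⟨q.re, q.imI⟩
    | false, true => ⟨q.imJ, q.imK⟩
    | true, false => ⟨-q.imJ, q.imK⟩
    | true, true => ⟨q.re, -q.imI⟩
  map_one' := by
    ext a b
    cases a <;> cases b <;> simp [Complex.ext_iff]
  map_zero' := by
    ext a b
    cases a <;> cases b <;> simp [Complex.ext_iff]
  map_add' p q := by
    ext a b
    cases a <;> cases b <;> simp [Complex.ext_iff] <;> ring
  map_mul' p q := by
    ext a b
    cases a <;> cases b <;>
      simp only [Matrix.of_apply, Matrix.mul_apply, Fintype.sum_bool, Complex.ext_iff,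
        Complex.add_re, Complex.add_im, Complex.mul_re, Complex.mul_im, Quaternion.re_mul,
        Quaternion.imI_mul, Quaternion.imJ_mul, Quaternion.imK_mul] <;>
      constructor <;> ring

theorem quatMatrix_star (q : ℍ[ℝ]) : quatMatrix (star q) = (quatMatrix q).conjTranspose := by
  ext a b
  cases a <;> cases b <;> simp [quatMatrix, Matrix.conjTranspose_apply, Complex.ext_iff]

theorem quatMatrix_smul (c : ℝ) (q : ℍ[ℝ]) : quatMatrix (c • q) = (c : ℂ) • quatMatrix q := by
  ext a b
  cases a <;> cases b <;> simp [quatMatrix, Complex.ext_iff]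

theorem norm_quatMatrix_apply_le (q : ℍ[ℝ]) (a b : Bool) : ‖quatMatrix q a b‖ ≤ ‖q‖ := by
  have h := Quaternion.normSq_eq_norm_mul_self q
  rw [Quaternion.normSq_def'] at h
  refine abs_le_of_sq_le_sq' ?_ (norm_nonneg _) |>.2
  rw [Complex.sq_norm, Complex.normSq_apply]
  cases a <;> cases b <;> simp [quatMatrix] <;> nlinarith [sq_nonneg q.re, sq_nonneg q.imI,
    sq_nonneg q.imJ, sq_nonneg q.imK]

theorem quaternion_mul_star {q : ℍ[ℝ]} (hq : ‖q‖ = 1) : q * star q = 1 := by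
  rw [Quaternion.self_mul_star, Quaternion.normSq_eq_norm_mul_self, hq]; simp

theorem quaternion_star_mul {q : ℍ[ℝ]} (hq : ‖q‖ = 1) : star q * q = 1 := by
  rw [Quaternion.star_mul_self, Quaternion.normSq_eq_norm_mul_self, hq]; simp

/-- Normalising a vector at most doubles its distance to a unit vector. -/
theorem norm_normalize_sub_le {E : Type*} [NormedAddCommGroup E] [NormedSpace ℝ E] {v e : E}
    (he : ‖e‖ = 1) (hv : v ≠ 0) : ‖(‖v‖)⁻¹ • v - e‖ ≤ 2 * ‖v - e‖ := by
  have hv0 : 0 < ‖v‖ := norm_pos_iff.2 hv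
  have h1 : ‖(‖v‖)⁻¹ • v - v‖ ≤ ‖v - e‖ := by
    have : (‖v‖)⁻¹ • v - v = ((‖v‖)⁻¹ - 1) • v := by rw [sub_smul, one_smul]
    rw [this, norm_smul, Real.norm_eq_abs, ← abs_of_pos hv0, ← abs_mul, abs_of_pos hv0, sub_mul,
      inv_mul_cancel₀ hv0.ne', one_mul, ← he, norm_sub_rev]
    exact abs_norm_sub_norm_le _ _
  calc ‖(‖v‖)⁻¹ • v - e‖ = ‖((‖v‖)⁻¹ • v - v) + (v - e)‖ := by congr 1; abel
    _ ≤ _ := norm_add_le _ _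
    _ ≤ _ := by linarith

theorem exists_unit_orthogonal (g : ℍ[ℝ]) :
    ∃ w : ℍ[ℝ], ‖w‖ = 1 ∧ w.re = 0 ∧ g.imI * w.imI + g.imJ * w.imJ + g.imK * w.imK = 0 := by
  have key : ∀ w : ℍ[ℝ], w ≠ 0 → w.re = 0 →
      g.imI * w.imI + g.imJ * w.imJ + g.imK * w.imK = 0 →
      ∃ w : ℍ[ℝ], ‖w‖ = 1 ∧ w.re = 0 ∧ g.imI * w.imI + g.imJ * w.imJ + g.imK * w.imK = 0 := by
    intro w hw h0 h1
    refine ⟨(‖w‖)⁻¹ • w, ?_, by simp [h0], ?_⟩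
    · rw [norm_smul, norm_inv, norm_norm, inv_mul_cancel₀ (norm_ne_zero_iff.2 hw)]
    · simp only [Quaternion.imI_smul, Quaternion.imJ_smul, Quaternion.imK_smul, smul_eq_mul]
      linear_combination (‖w‖)⁻¹ * h1
  by_cases h : g.imI = 0 ∧ g.imJ = 0
  · exact key ⟨0, 1, 0, 0⟩ (fun h' => by simpa using congrArg QuaternionAlgebra.imI h') rfl
      (by simp [h.1])
  · refine key ⟨0, -g.imJ, g.imI, 0⟩ (fun h' => h ⟨?_, ?_⟩) rfl (by simp; ring)
    · simpa using congrArg QuaternionAlgebra.imJ h'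
    · simpa using congrArg QuaternionAlgebra.imI h'

/-- Two nearby imaginary quaternions of equal norm are conjugate by a unit quaternion that is close
to `1`, namely by the normalisation of `‖x‖² - y x`. -/
theorem exists_conjugating {x y : ℍ[ℝ]} (hxs : star x = -x) (hys : star y = -y)
    (hxy : ‖x‖ = ‖y‖) (hx0 : 0 < ‖x‖) {τ : ℝ} (hτ : τ < 1) (hyx : ‖y - x‖ ≤ 2 * ‖x‖ * τ) :
    ∃ c : ℍ[ℝ], ‖c‖ = 1 ∧ ‖c - 1‖ ≤ 2 * τ ∧ c * x = y * c := by
  obtain ⟨N, hN⟩ : ∃ N : ℝ, N = ‖x‖ ^ 2 := ⟨_, rfl⟩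
  have hN0 : 0 < N := by rw [hN]; positivity
  have hxx : x * x = -(N : ℍ[ℝ]) := by
    have := Quaternion.self_mul_star x
    rw [hxs, Quaternion.normSq_eq_norm_mul_self, ← sq, mul_neg, ← hN] at this
    rw [← this, neg_neg]
  have hyy : y * y = -(N : ℍ[ℝ]) := by
    have := Quaternion.self_mul_star y
    rw [hys, Quaternion.normSq_eq_norm_mul_self, ← sq, mul_neg, ← hxy, ← hN] at this
    rw [← this, neg_neg]
  obtain ⟨c, hc⟩ : ∃ c : ℍ[ℝ], c = 1 - (2 * N)⁻¹ • ((y - x) * x) := ⟨_, rfl⟩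
  have hcx : c = (2 * N)⁻¹ • ((N : ℍ[ℝ]) - y * x) := by
    have h3 : (1 : ℍ[ℝ]) = (2 * N)⁻¹ • ((2 * N : ℝ) : ℍ[ℝ]) := by
      rw [← Quaternion.coe_smul, smul_eq_mul, inv_mul_cancel₀ (by positivity), Quaternion.coe_one]
    rw [hc, sub_mul, hxx]
    nth_rewrite 1 [h3]
    rw [← smul_sub]
    congr 1
    rw [two_mul, Quaternion.coe_add]
    abel
  have hcomm : c * x = y * c := by
    have e1 : ((N : ℍ[ℝ]) - y * x) * x = y * ((N : ℍ[ℝ]) - y * x) := by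
      rw [sub_mul, mul_sub, mul_assoc, hxx, ← mul_assoc, hyy, mul_neg, neg_mul, sub_neg_eq_add,
        sub_neg_eq_add, add_comm]
    rw [hcx, smul_mul_assoc, mul_smul_comm, e1]
  have hc1 : ‖c - 1‖ ≤ τ := by
    have e1 : c - 1 = -((2 * N)⁻¹ • ((y - x) * x)) := by rw [hc]; abel
    rw [e1, norm_neg, norm_smul, norm_mul, Real.norm_of_nonneg (by positivity), hN]
    have : (2 * ‖x‖ ^ 2)⁻¹ * (‖y - x‖ * ‖x‖) = ‖y - x‖ / (2 * ‖x‖) := by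
      field_simp
    rw [this, div_le_iff₀ (by positivity)]
    linarith
  have hc0 : c ≠ 0 := by
    intro h0
    rw [h0, zero_sub, norm_neg, norm_one] at hc1
    linarith
  refine ⟨(‖c‖)⁻¹ • c, ?_, ?_, ?_⟩
  · rw [norm_smul, norm_inv, norm_norm, inv_mul_cancel₀ (norm_ne_zero_iff.2 hc0)]
  · exact (norm_normalize_sub_le norm_one hc0).trans (by linarith)
  · rw [smul_mul_assoc, mul_smul_comm, hcomm]

theorem norm_im_sq (p : ℍ[ℝ]) : ‖p.im‖ ^ 2 = ‖p‖ ^ 2 - p.re ^ 2 := by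
  have e1 := Quaternion.normSq_eq_norm_mul_self p
  have e3 := Quaternion.normSq_eq_norm_mul_self p.im
  rw [Quaternion.normSq_def'] at e1 e3
  simp only [Quaternion.re_im, Quaternion.imI_im, Quaternion.imJ_im, Quaternion.imK_im] at e3
  rw [sq ‖p.im‖, ← e3, sq ‖p‖, ← e1]
  ring

/-- A unit quaternion at distance `σ²` from `1` is the commutator of two unit quaternions at
distance `O(σ)` from `1`: it is the quotient of two nearby quaternions with equal real parts. -/
theorem exists_commutator {g : ℍ[ℝ]} (hg : ‖g‖ = 1) {σ : ℝ} (hσ : 0 < σ) (hσ' : σ ≤ 1 / 2)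
    (h : ‖g - 1‖ ≤ σ ^ 2) :
    ∃ p c : ℍ[ℝ], ‖p‖ = 1 ∧ ‖c‖ = 1 ∧ ‖p - 1‖ ≤ 4 * σ ∧ ‖c - 1‖ ≤ 4 * σ ∧
      g = p * c * star p * star c := by
  obtain ⟨w, hw, hw0, hwg⟩ := exists_unit_orthogonal g
  -- As `g` commutes with `1 + g` and `w` is orthogonal to the imaginary part of `g`, the quaternions
  -- `p` and `q = g⁻¹ p = (1 + g⁻¹) (1 + σ w)` have equal norms and real parts, so some `c` near `1`
  -- satisfies `c p = q c`, which says `g = p q⁻¹ = p c p⁻¹ c⁻¹`. The summand `σ w` keeps the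
  -- imaginary parts of `p` and `q` long in comparison with their distance `O(σ²)`.
  obtain ⟨p, hp⟩ : ∃ p : ℍ[ℝ], p = (1 + g) * (1 + σ • w) := ⟨_, rfl⟩
  obtain ⟨q, hq⟩ : ∃ q : ℍ[ℝ], q = star g * p := ⟨_, rfl⟩
  have hgg : star g * g = 1 := quaternion_star_mul hg
  have hgg' : g * star g = 1 := quaternion_mul_star hg
  have hq' : q = (1 + star g) * (1 + σ • w) := by
    have : star g * (1 + g) = 1 + star g := by rw [mul_add, mul_one, hgg, add_comm]
    rw [hq, hp, ← mul_assoc, this]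
  have hg0 : g.re ^ 2 + g.imI ^ 2 + g.imJ ^ 2 + g.imK ^ 2 = 1 := by
    have := Quaternion.normSq_eq_norm_mul_self g
    rwa [hg, Quaternion.normSq_def', one_mul] at this
  have hw1 : w.imI ^ 2 + w.imJ ^ 2 + w.imK ^ 2 = 1 := by
    have := Quaternion.normSq_eq_norm_mul_self w
    rw [hw, Quaternion.normSq_def', hw0] at this
    linarith
  have hpre : p.re = 1 + g.re := by
    rw [hp]
    simp [Quaternion.re_mul, hw0]
    linear_combination (-σ) * hwg
  have hre : p.re = q.re := by
    rw [hpre, hq']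
    simp [Quaternion.re_mul, hw0]
    linear_combination (-σ) * hwg
  have hnorm : ‖p‖ = ‖q‖ := by rw [hq, norm_mul, Quaternion.norm_star, hg, one_mul]
  have hgre : 3 / 4 ≤ g.re := by
    have h1 : (g - 1).re ^ 2 ≤ ‖g - 1‖ ^ 2 := by
      have := norm_im_sq (g - 1)
      nlinarith [sq_nonneg ‖(g - 1).im‖]
    have h2 : |(g - 1).re| ≤ ‖g - 1‖ := abs_le_of_sq_le_sq h1 (norm_nonneg _)
    have h3 : (g - 1).re = g.re - 1 := by simp
    rw [h3] at h2
    have := (abs_le.1 h2).1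
    nlinarith
  have hw' : ‖σ • w‖ = σ := by rw [norm_smul, hw, mul_one, Real.norm_of_nonneg hσ.le]
  have hsw : ‖(1 : ℍ[ℝ]) + σ • w‖ ^ 2 = 1 + σ ^ 2 := by
    have := norm_im_sq (1 + σ • w)
    have e : ((1 : ℍ[ℝ]) + σ • w).im = σ • w := by ext <;> simp [hw0]
    rw [e, hw'] at this
    simp [hw0] at this
    linarith
  have hsw' : ‖(1 : ℍ[ℝ]) + σ • w‖ ≤ 3 / 2 := by
    refine (norm_add_le _ _).trans ?_
    rw [hw', norm_one]; linarith
  have hgp : ‖1 + g‖ ^ 2 = 2 + 2 * g.re := by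
    have := Quaternion.normSq_eq_norm_mul_self (1 + g)
    rw [Quaternion.normSq_def'] at this
    rw [sq, ← this]
    simp
    linear_combination hg0
  have hxn : σ ≤ ‖p.im‖ := by
    refine abs_le_of_sq_le_sq' ?_ (norm_nonneg _) |>.2
    rw [norm_im_sq, hpre, hp, norm_mul, mul_pow, hsw, hgp]
    have hg1 : g.re ≤ 1 := by nlinarith [sq_nonneg g.imI, sq_nonneg g.imJ, sq_nonneg g.imK]
    nlinarith [mul_nonneg (sq_nonneg σ) (by linarith : (0 : ℝ) ≤ 1 + 2 * g.re),
      mul_nonneg (by linarith : (0 : ℝ) ≤ 1 - g.re) (by linarith : (0 : ℝ) ≤ 1 + g.re)]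
  have hyx : ‖q.im - p.im‖ ≤ 2 * ‖p.im‖ * (3 / 2 * σ) := by
    have e1 : q.im - p.im = q - p := by
      rw [← Quaternion.sub_re_self, ← Quaternion.sub_re_self p, hre]; abel
    have e2 : ‖star g - 1‖ ≤ σ ^ 2 := by
      rw [← Quaternion.norm_star, star_sub, star_star, star_one]; exact h
    have e3 : ‖1 - g‖ ≤ σ ^ 2 := by rwa [norm_sub_rev]
    have e5 : ‖(star g - 1) + (1 - g)‖ ≤ 2 * σ ^ 2 := (norm_add_le _ _).trans (by linarith)
    have e6 : q - p = ((star g - 1) + (1 - g)) * (1 + σ • w) := by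
      rw [hq', hp, ← sub_mul]; congr 1; abel
    rw [e1, e6, norm_mul]
    calc _ ≤ 2 * σ ^ 2 * (3 / 2) := mul_le_mul e5 hsw' (norm_nonneg _) (by positivity)
      _ ≤ _ := by nlinarith
  have him : ‖p.im‖ = ‖q.im‖ := by
    rw [← sq_eq_sq₀ (norm_nonneg _) (norm_nonneg _), norm_im_sq, norm_im_sq, hnorm, hre]
  obtain ⟨c, hc, hc1, hcomm⟩ := exists_conjugating (Quaternion.star_im p) (Quaternion.star_im q) him
    (hσ.trans_le hxn) (by linarith) hyx
  have hcpq : c * p = q * c := by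
    rw [← Quaternion.re_add_im p, ← Quaternion.re_add_im q, mul_add, add_mul, hcomm, hre,
      Quaternion.coe_commutes]
  have hp1 : ‖(1 / 2 : ℝ) • p - 1‖ ≤ 2 * σ := by
    have e1 : (1 / 2 : ℝ) • p - 1 = (1 / 2 : ℝ) • ((g - 1) * (1 + σ • w)) + σ • w := by
      rw [hp]
      have : (1 : ℍ[ℝ]) + g = (g - 1) + (2 : ℝ) • 1 := by
        rw [two_smul]; abel
      rw [this, add_mul, smul_add, smul_mul_assoc, one_mul, smul_smul]
      norm_num
      abel
    rw [e1]
    refine (norm_add_le _ _).trans ?_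
    rw [norm_smul, norm_mul, hw']
    have e5 : ‖g - 1‖ * ‖(1 : ℍ[ℝ]) + σ • w‖ ≤ σ ^ 2 * (3 / 2) :=
      mul_le_mul h hsw' (norm_nonneg _) (by positivity)
    rw [Real.norm_of_nonneg (by norm_num)]
    nlinarith
  have hp0 : p ≠ 0 := by
    intro h0
    rw [h0] at hpre
    simp at hpre
    linarith
  have hpn : (‖(1 / 2 : ℝ) • p‖)⁻¹ • (1 / 2 : ℝ) • p = (‖p‖)⁻¹ • p := by
    rw [norm_smul, smul_smul, Real.norm_of_nonneg (by norm_num)]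
    congr 1
    field_simp
  have hP : ‖(‖p‖)⁻¹ • p‖ = 1 := by
    rw [norm_smul, norm_inv, norm_norm, inv_mul_cancel₀ (norm_ne_zero_iff.2 hp0)]
  refine ⟨(‖p‖)⁻¹ • p, c, hP, hc, ?_, by linarith, ?_⟩
  · rw [← hpn]
    refine (norm_normalize_sub_le norm_one (smul_ne_zero (by norm_num) hp0)).trans ?_
    linarith
  · obtain ⟨P, hPp⟩ : ∃ P : ℍ[ℝ], P = (‖p‖)⁻¹ • p := ⟨_, rfl⟩
    rw [← hPp] at hP ⊢
    have e1 : c * P = star g * P * c := by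
      rw [hPp, mul_smul_comm, hcpq, hq, mul_smul_comm, smul_mul_assoc]
    have e2 : P * c = g * (c * P) := by
      rw [e1, ← mul_assoc, ← mul_assoc, hgg', one_mul]
    rw [e2, mul_assoc g, mul_assoc c, quaternion_mul_star hP, mul_one, mul_assoc,
      quaternion_mul_star hc, mul_one]

/-! ### Sequences of small two-qubit gates -/

section Action

variable {n : ℕ}

theorem toEuclideanLin_mul_apply (A B : Op n) (v : Qubits n) :
    Matrix.toEuclideanLin (A * B) v = Matrix.toEuclideanLin A (Matrix.toEuclideanLin B v) := by
  simp [Matrix.toLpLin_apply, Matrix.mulVec_mulVec]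

theorem toEuclideanLin_one_apply (v : Qubits n) :
    Matrix.toEuclideanLin (1 : Op n) v = v := by
  simp

theorem norm_toEuclideanLin_of_mem_unitaryGroup {U : Op n}
    (hU : U ∈ Matrix.unitaryGroup (Bits n) ℂ) (v : Qubits n) :
    ‖Matrix.toEuclideanLin U v‖ = ‖v‖ := by
  have h : U.conjTranspose * U = 1 := Matrix.mem_unitaryGroup_iff'.1 hU
  have h2 : inner ℂ (Matrix.toEuclideanLin U v) (Matrix.toEuclideanLin U v) = inner ℂ v v := by
    rw [← LinearMap.adjoint_inner_right, ← Matrix.toEuclideanLin_conjTranspose_eq_adjoint,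
      ← toEuclideanLin_mul_apply, h, toEuclideanLin_one_apply]
  rw [@norm_eq_sqrt_re_inner ℂ, @norm_eq_sqrt_re_inner ℂ _ _ _ _ v, h2]

theorem norm_le_sum_norm (v : Qubits n) : ‖v‖ ≤ ∑ x, ‖v x‖ := by
  have h : v = ∑ x, v x • EuclideanSpace.single x (1 : ℂ) := by
    ext y
    simp [Pi.single_apply]
  conv_lhs => rw [h]
  refine (norm_sum_le _ _).trans (Finset.sum_le_sum fun x _ => ?_)
  rw [norm_smul, PiLp.norm_single, norm_one, mul_one]

theorem card_bits (n : ℕ) : Fintype.card (Bits n) = 2 ^ n := by simp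

/-- A crude bound on an operator in terms of its entries; exponential losses are harmless. -/
theorem norm_toEuclideanLin_le {M : Op n} {r : ℝ} (hM : ∀ x y, ‖M x y‖ ≤ r) (v : Qubits n) :
    ‖Matrix.toEuclideanLin M v‖ ≤ 4 ^ n * r * ‖v‖ := by
  have h1 : ∀ x, ‖Matrix.toEuclideanLin M v x‖ ≤ 2 ^ n * (r * ‖v‖) := fun x => by
    rw [Matrix.ofLp_toLpLin, Matrix.toLin'_apply, Matrix.mulVec, dotProduct]
    refine (norm_sum_le_of_le _ fun y _ => ?_).trans
      (b := ∑ _y : Bits n, r * ‖v‖) (le_of_eq ?_)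
    · rw [norm_mul]
      exact mul_le_mul (hM x y) (PiLp.norm_apply_le v y) (norm_nonneg _)
        ((norm_nonneg _).trans (hM x y))
    · rw [Finset.sum_const, Finset.card_univ, card_bits, nsmul_eq_mul]
      push_cast
      rfl
  refine (norm_le_sum_norm _).trans ((Finset.sum_le_sum fun x _ => h1 x).trans (le_of_eq ?_))
  rw [Finset.sum_const, Finset.card_univ, card_bits, nsmul_eq_mul, show (4 : ℝ) = 2 * 2 by norm_num,
    mul_pow]
  push_cast
  ring

@[simp]
theorem run_nil (v : Qubits n) : run [] v = v := rfl

@[simp]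
theorem run_cons (U : Op n) (Us : List (Op n)) (v : Qubits n) :
    run (U :: Us) v = run Us (Matrix.toEuclideanLin U v) := rfl

theorem run_append (Us Vs : List (Op n)) (v : Qubits n) :
    run (Us ++ Vs) v = run Vs (run Us v) := List.foldl_append

theorem norm_run {Us : List (Op n)} (h : ∀ U ∈ Us, U ∈ Matrix.unitaryGroup (Bits n) ℂ)
    (v : Qubits n) : ‖run Us v‖ = ‖v‖ := by
  induction Us generalizing v with
  | nil => rfl
  | cons U Us ih =>
    rw [run_cons, ih fun V hV => h V (List.mem_cons_of_mem _ hV),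
      norm_toEuclideanLin_of_mem_unitaryGroup (h U List.mem_cons_self)]

/-- A two-local unitary whose entries differ from those of the identity by at most `r`. -/
structure IsSmallGate (r : ℝ) (V : Op n) : Prop where
  unitary : V ∈ Matrix.unitaryGroup (Bits n) ℂ
  local_two : IsLocal 2 V
  close : ∀ x y, ‖(V - 1) x y‖ ≤ r

/-- `U` is a product of `L` small two-local gates, where products are given by their action on
states. -/
def IsWord (r : ℝ) (L : ℕ) (U : Op n) : Prop :=
  ∃ Us : List (Op n), Us.length = L ∧ (∀ V ∈ Us, IsSmallGate r V) ∧
    ∀ v, run Us v = Matrix.toEuclideanLin U v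

theorem IsSmallGate.isWord {r : ℝ} {V : Op n} (h : IsSmallGate r V) : IsWord r 1 V :=
  ⟨[V], rfl, by simpa using h, fun _ => rfl⟩

theorem IsWord.mul {r : ℝ} {K L : ℕ} {U V : Op n} (hU : IsWord r K U) (hV : IsWord r L V) :
    IsWord r (K + L) (U * V) := by
  obtain ⟨Us, rfl, hUs, hU⟩ := hU
  obtain ⟨Vs, rfl, hVs, hV⟩ := hV
  refine ⟨Vs ++ Us, by rw [List.length_append, add_comm], fun W hW => ?_, fun v => ?_⟩
  · rcases List.mem_append.1 hW with h | h
    · exact hVs W h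
    · exact hUs W h
  · rw [run_append, hV, hU, toEuclideanLin_mul_apply]

theorem norm_run_sub_le {r : ℝ} {Us : List (Op n)} (h : ∀ V ∈ Us, IsSmallGate r V)
    (v : Qubits n) : ‖run Us v - v‖ ≤ Us.length * (4 ^ n * r) * ‖v‖ := by
  induction Us generalizing v with
  | nil => simp
  | cons U Us ih =>
    have hU := h U List.mem_cons_self
    have h1 := ih (fun V hV => h V (List.mem_cons_of_mem _ hV)) (Matrix.toEuclideanLin U v)
    rw [norm_toEuclideanLin_of_mem_unitaryGroup hU.unitary] at h1
    have h2 : ‖Matrix.toEuclideanLin U v - v‖ ≤ 4 ^ n * r * ‖v‖ := by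
      have := norm_toEuclideanLin_le hU.close v
      rwa [map_sub, LinearMap.sub_apply, toEuclideanLin_one_apply] at this
    rw [run_cons]
    calc _ ≤ _ := norm_sub_le_norm_sub_add_norm_sub _ (Matrix.toEuclideanLin U v) _
      _ ≤ _ := add_le_add h1 h2
      _ = _ := by push_cast [List.length_cons]; ring

end Action

/-! ### Implementing controlled operations and phases -/

/-- Controlled gates with up to `2 ^ d` controls are products of `4 ^ d` small two-qubit gates,
by repeatedly halving the set of controls with a commutator. Each halving takes a square root of
the distance to the identity; as there are only logarithmically many, the gates
have to be only exponentially close to the identity. -/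
theorem isWord_controlled {n : ℕ} {Q : Fin n → Matrix Bool Bool ℂ} (hQ : ∀ i, Q i * Q i = Q i)
    (hQ' : ∀ i, (Q i).conjTranspose = Q i) (hQ1 : ∀ i a b, ‖Q i a b‖ ≤ 1) {t : Fin n} {r : ℝ}
    (hr : 0 < r) (hr1 : r ≤ 1) (d : ℕ) (S : Finset (Fin n)) (hS : S.card ≤ 2 ^ d) (ht : t ∉ S)
    (g : ℍ[ℝ]) (hg : ‖g‖ = 1) (hgr : ‖g - 1‖ ≤ 16 * (r / 16) ^ 2 ^ d) :
    IsWord r (4 ^ d) (1 + controlled Q S t (quatMatrix g - 1)) := by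
  induction d generalizing S g with
  | zero =>
    refine IsSmallGate.isWord ⟨?_, ?_, fun x y => ?_⟩
    · refine controlled_mem_unitaryGroup hQ hQ' ?_
      rw [← quatMatrix_star, ← map_mul, quaternion_mul_star hg, map_one]
    · obtain ⟨j, hj, h⟩ := isLocal_controlled (Q := Q) ht (quatMatrix g - 1)
      refine ⟨j, hj.trans ?_, h⟩
      rw [pow_zero] at hS
      omega
    · rw [add_sub_cancel_left]
      refine norm_controlled_apply_le hQ1 (fun a b => ?_) x y
      have := norm_quatMatrix_apply_le (g - 1) a b
      rw [map_sub, map_one] at this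
      refine this.trans (hgr.trans (le_of_eq ?_))
      rw [pow_zero, pow_one]
      ring
  | succ d ih =>
    obtain ⟨A, hAS, hA⟩ := Finset.exists_subset_card_eq (min_le_right (2 ^ d) S.card)
    have hρ : 0 < r / 16 := by positivity
    obtain ⟨p, c, hp, hc, hp1, hc1, rfl⟩ := exists_commutator hg
      (σ := 4 * (r / 16) ^ 2 ^ d) (by positivity)
      (by
        have : (r / 16) ^ 2 ^ d ≤ r / 16 :=
          pow_le_of_le_one hρ.le (by linarith) (by positivity)
        linarith)
      (by
        refine hgr.trans (le_of_eq ?_)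
        rw [pow_succ 2 d, pow_mul]
        ring)
    have hst : ∀ q : ℍ[ℝ], ‖star q - 1‖ = ‖q - 1‖ := fun q => by
      rw [← Quaternion.norm_star, star_sub, star_star, star_one]
    have hA1 : A.card ≤ 2 ^ d := hA.le.trans (min_le_left _ _)
    have hA2 : (S \ A).card ≤ 2 ^ d := by
      rw [Finset.card_sdiff_of_subset hAS, hA]
      rw [pow_succ] at hS
      omega
    have hB : t ∉ S \ A := fun h => ht (Finset.mem_sdiff.1 h).1
    have h16 : 4 * (4 * (r / 16) ^ 2 ^ d) = 16 * (r / 16) ^ 2 ^ d := by ring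
    rw [h16] at hp1 hc1
    have w1 := ih A hA1 (fun h => ht (hAS h)) p hp hp1
    have w2 := ih (S \ A) hA2 hB c hc hc1
    have w3 := ih A hA1 (fun h => ht (hAS h)) (star p) (by rwa [Quaternion.norm_star])
      (by rwa [hst])
    have w4 := ih (S \ A) hA2 hB (star c) (by rwa [Quaternion.norm_star]) (by rwa [hst])
    have w := ((w1.mul w2).mul w3).mul w4
    rw [controlled_commutator hQ (by rw [← map_mul, quaternion_mul_star hp, map_one])
      (by rw [← map_mul, quaternion_mul_star hc, map_one]), Finset.union_sdiff_of_subset hAS,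
      ← map_mul, ← map_mul, ← map_mul] at w
    convert w using 1
    rw [pow_succ]
    ring

/-- The one-qubit projector `(1 - i u) / 2` of an imaginary unit quaternion `u`. -/
noncomputable def qubitProj (u : ℍ[ℝ]) : Matrix Bool Bool ℂ :=
  (1 / 2 : ℂ) • (1 - Complex.I • quatMatrix u)

theorem norm_eq_one_of_imaginary {u : ℍ[ℝ]} (hu : u * u = -1) : ‖u‖ = 1 := by
  have h := congrArg norm hu
  rw [norm_mul, norm_neg, norm_one] at h
  nlinarith [norm_nonneg u]

theorem qubitProj_mul_self {u : ℍ[ℝ]} (hu : u * u = -1) :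
    qubitProj u * qubitProj u = qubitProj u := by
  have h : quatMatrix u * quatMatrix u = -1 := by rw [← map_mul, hu, map_neg, map_one]
  rw [qubitProj, smul_mul_smul_comm, sub_mul, mul_sub, mul_sub, smul_mul_smul_comm, h,
    Complex.I_mul_I, one_mul, mul_one, one_mul]
  module

theorem qubitProj_conjTranspose {u : ℍ[ℝ]} (hu : star u = -u) :
    (qubitProj u).conjTranspose = qubitProj u := by
  rw [qubitProj, Matrix.conjTranspose_smul, Matrix.conjTranspose_sub, Matrix.conjTranspose_one,
    Matrix.conjTranspose_smul, ← quatMatrix_star, hu, map_neg]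
  simp

theorem norm_qubitProj_apply_le {u : ℍ[ℝ]} (hu : u * u = -1) (a b : Bool) :
    ‖qubitProj u a b‖ ≤ 1 := by
  have h := norm_quatMatrix_apply_le u a b
  rw [norm_eq_one_of_imaginary hu] at h
  have h1 : ‖(1 : Matrix Bool Bool ℂ) a b‖ ≤ 1 := by
    rw [Matrix.one_apply]; split_ifs <;> simp
  have h2 : ‖(1 - Complex.I • quatMatrix u) a b‖ ≤ 1 + 1 := by
    rw [Matrix.sub_apply, Matrix.smul_apply]
    refine (norm_sub_le _ _).trans (add_le_add h1 ?_)
    rwa [norm_smul, Complex.norm_I, one_mul]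
  have h3 : ‖(1 / 2 : ℂ)‖ = 1 / 2 := by norm_num
  rw [qubitProj, Matrix.smul_apply, norm_smul, h3]
  linarith

/-- The projector `⨂_{i ∈ S} (1 - i uᵢ) / 2`, acting trivially off `S`. -/
noncomputable def productProj {n : ℕ} (u : Fin n → ℍ[ℝ]) (S : Finset (Fin n)) : Op n :=
  tensor fun i => if i ∈ S then qubitProj (u i) else 1

theorem productProj_empty {n : ℕ} (u : Fin n → ℍ[ℝ]) : productProj u ∅ = 1 := by
  simp [productProj, tensor_one]

/-- `exp (i θ P) = 1 + (exp (i θ) - 1) P` for the projector `P = productProj u S`. -/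
noncomputable def phase {n : ℕ} (u : Fin n → ℍ[ℝ]) (S : Finset (Fin n)) (θ : ℝ) : Op n :=
  1 + (Complex.exp (Complex.I * θ) - 1) • productProj u S

/-- On a projector of rank one, a phase is half a phase on the other qubits times a controlled
rotation. -/
theorem phase_insert {n : ℕ} {u : Fin n → ℍ[ℝ]} (hu : ∀ i, u i * u i = -1)
    {S : Finset (Fin n)} {t : Fin n} (ht : t ∉ S) (θ : ℝ) :
    phase u (insert t S) θ =
      (1 + controlled (fun i => qubitProj (u i)) S t
        (quatMatrix ((Real.cos (θ / 2) : ℍ[ℝ]) + Real.sin (θ / 2) • u t) - 1)) *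
        phase u S (θ / 2) := by
  have h1 : productProj u S = controlled (fun i => qubitProj (u i)) S t 1 := by
    rw [productProj, controlled_apply]
    congr 1
    funext i
    by_cases h : i = t
    · simp [h, ht]
    · simp [h]
  have h2 : productProj u (insert t S) =
      controlled (fun i => qubitProj (u i)) S t (qubitProj (u t)) := by
    rw [productProj, controlled_apply]
    congr 1
    funext i
    by_cases h : i = t
    · simp [h]
    · simp [h]
  have hQ : ∀ i, qubitProj (u i) * qubitProj (u i) = qubitProj (u i) := fun i =>
    qubitProj_mul_self (hu i)
  have hq : quatMatrix ((Real.cos (θ / 2) : ℍ[ℝ]) + Real.sin (θ / 2) • u t) =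
      (Real.cos (θ / 2) : ℂ) • 1 + (Real.sin (θ / 2) : ℂ) • quatMatrix (u t) := by
    have : (Real.cos (θ / 2) : ℍ[ℝ]) = Real.cos (θ / 2) • (1 : ℍ[ℝ]) := by
      rw [← Quaternion.coe_one, ← Quaternion.coe_smul, smul_eq_mul, mul_one]
    rw [map_add, quatMatrix_smul, this, quatMatrix_smul, map_one]
  have hz : Complex.exp (Complex.I * ((θ / 2 : ℝ) : ℂ)) =
      (Real.cos (θ / 2) : ℂ) + Real.sin (θ / 2) * Complex.I := by
    rw [mul_comm, Complex.exp_mul_I, Complex.ofReal_cos, Complex.ofReal_sin]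
  have hz2 : Complex.exp (Complex.I * θ) =
      Complex.exp (Complex.I * ((θ / 2 : ℝ) : ℂ)) * Complex.exp (Complex.I * ((θ / 2 : ℝ) : ℂ)) := by
    rw [← Complex.exp_add]
    congr 1
    push_cast
    ring
  have hcs : (Real.cos (θ / 2) : ℂ) ^ 2 + (Real.sin (θ / 2) : ℂ) ^ 2 = 1 := by
    exact_mod_cast Real.cos_sq_add_sin_sq (θ / 2)
  rw [phase, phase, h1, h2, hz2, hz, hq]
  generalize (Real.cos (θ / 2) : ℂ) = c at *
  generalize (Real.sin (θ / 2) : ℂ) = s at *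
  have hmul : ∀ (a : Matrix Bool Bool ℂ) (z : ℂ),
      (1 + controlled (fun i => qubitProj (u i)) S t a) *
        (1 + z • controlled (fun i => qubitProj (u i)) S t 1) =
      1 + controlled (fun i => qubitProj (u i)) S t (a + z • 1 + z • a) := fun a z => by
    rw [map_add, map_add, controlled_smul, controlled_smul, add_mul, mul_add, mul_add,
      mul_smul_comm, mul_smul_comm, controlled_mul hQ, Finset.union_self, one_mul, mul_one, mul_one,
      one_mul]
    abel
  rw [hmul, ← controlled_smul, qubitProj]
  congr 2
  have hI : Complex.I ^ 2 = -1 := Complex.I_sq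
  match_scalars
  · linear_combination (-1 / 2) * hcs + (s ^ 2 / 2) * hI
  · linear_combination (-Complex.I / 2) * hcs + (-c * s - s ^ 2 * Complex.I / 2) * hI

theorem norm_cos_add_sin_smul {u : ℍ[ℝ]} (hu : u * u = -1) (hu' : star u = -u) (θ : ℝ) :
    ‖(Real.cos θ : ℍ[ℝ]) + Real.sin θ • u‖ = 1 := by
  have h1 : u.re = 0 := by
    have := congrArg QuaternionAlgebra.re hu'
    simp at this
    linarith
  have h2 := norm_im_sq u
  rw [norm_eq_one_of_imaginary hu, h1] at h2
  have h3 := norm_im_sq ((Real.cos θ : ℍ[ℝ]) + Real.sin θ • u)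
  have h4 : ((Real.cos θ : ℍ[ℝ]) + Real.sin θ • u).im = Real.sin θ • u.im := by
    ext <;> simp
  have h5 : ((Real.cos θ : ℍ[ℝ]) + Real.sin θ • u).re = Real.cos θ := by
    simp [h1]
  rw [h4, h5, norm_smul, mul_pow, h2, Real.norm_eq_abs, sq_abs] at h3
  have h6 : ‖(Real.cos θ : ℍ[ℝ]) + Real.sin θ • u‖ ^ 2 = 1 := by
    nlinarith [Real.cos_sq_add_sin_sq θ]
  nlinarith [norm_nonneg ((Real.cos θ : ℍ[ℝ]) + Real.sin θ • u)]

theorem norm_cos_add_sin_smul_sub_one_le {u : ℍ[ℝ]} (hu : u * u = -1) (θ : ℝ) :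
    ‖(Real.cos θ : ℍ[ℝ]) + Real.sin θ • u - 1‖ ≤ 2 * |θ| := by
  have h1 : (Real.cos θ : ℍ[ℝ]) + Real.sin θ • u - 1 =
      ((Real.cos θ - 1 : ℝ) : ℍ[ℝ]) + Real.sin θ • u := by
    rw [Quaternion.coe_sub, Quaternion.coe_one]; abel
  have h2 : |Real.cos θ - 1| ≤ |θ| := by
    have := Real.abs_cos_sub_cos_le θ 0
    simpa using this
  rw [h1]
  refine (norm_add_le _ _).trans ?_
  rw [Quaternion.norm_coe, norm_smul, norm_eq_one_of_imaginary hu, mul_one, Real.norm_eq_abs,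
    Real.norm_eq_abs]
  linarith [Real.abs_sin_le_abs (x := θ)]

theorem norm_exp_sub_one_le (θ : ℝ) : ‖Complex.exp (Complex.I * θ) - 1‖ ≤ |θ| :=
  Real.norm_exp_I_mul_ofReal_sub_one_le

theorem smul_one_mem_unitaryGroup {n : ℕ} {z : ℂ} (hz : ‖z‖ = 1) :
    z • (1 : Op n) ∈ Matrix.unitaryGroup (Bits n) ℂ := by
  rw [Matrix.mem_unitaryGroup_iff, Matrix.star_eq_conjTranspose, Matrix.conjTranspose_smul,
    Matrix.conjTranspose_one, smul_mul_smul_comm, one_mul, Complex.star_def, Complex.mul_conj',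
    hz]
  simp

theorem isLocal_smul_one {n : ℕ} (l : ℕ) (z : ℂ) : IsLocal l (z • (1 : Op n)) := by
  refine ⟨0, Nat.zero_le _, ⟨Fin.elim0, fun a => a.elim0⟩, z • 1, ?_⟩
  have h := embed_one (n := n) ⟨Fin.elim0, fun a => a.elim0⟩
  rw [← h]
  ext x y
  simp [embed]

theorem isWord_phase {n : ℕ} {u : Fin n → ℍ[ℝ]} (hu : ∀ i, u i * u i = -1)
    (hu' : ∀ i, star (u i) = -u i) {r : ℝ} (hr : 0 < r) (hr1 : r ≤ 1) {d : ℕ} (hd : n ≤ 2 ^ d)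
    (S : Finset (Fin n)) (θ : ℝ) (hθ : |θ| ≤ 16 * (r / 16) ^ 2 ^ d) :
    IsWord r (S.card * 4 ^ d + 1) (phase u S θ) := by
  induction S using Finset.induction_on generalizing θ with
  | empty =>
    have h : phase u ∅ θ = Complex.exp (Complex.I * θ) • 1 := by
      rw [phase, productProj_empty, sub_smul, one_smul]; abel
    have hz : ‖Complex.exp (Complex.I * θ)‖ = 1 := by
      rw [mul_comm]; exact Complex.norm_exp_ofReal_mul_I θ
    rw [h, Finset.card_empty, zero_mul, zero_add]
    refine IsSmallGate.isWord ⟨smul_one_mem_unitaryGroup hz, isLocal_smul_one _ _, fun x y => ?_⟩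
    have h2 : Complex.exp (Complex.I * θ) • (1 : Op n) - 1 =
        (Complex.exp (Complex.I * θ) - 1) • (1 : Op n) := by rw [sub_smul, one_smul]
    have h3 : (r / 16) ^ 2 ^ d ≤ r / 16 :=
      pow_le_of_le_one (by positivity) (by linarith) (by positivity)
    have h4 : ‖(1 : Op n) x y‖ ≤ 1 := by
      rw [Matrix.one_apply]; split_ifs <;> simp
    rw [h2, Matrix.smul_apply, norm_smul]
    calc _ ≤ |θ| * 1 := mul_le_mul (norm_exp_sub_one_le θ) h4 (norm_nonneg _) (abs_nonneg _)
      _ ≤ r := by linarith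
  | insert t S ht ih =>
    have hS : S.card ≤ 2 ^ d := by
      have := Finset.card_le_univ S
      rw [Fintype.card_fin] at this
      omega
    have h2 : |θ / 2| = |θ| / 2 := by rw [abs_div, abs_two]
    rw [phase_insert hu ht, Finset.card_insert_of_notMem ht]
    have w1 := isWord_controlled (Q := fun i => qubitProj (u i))
      (fun i => qubitProj_mul_self (hu i)) (fun i => qubitProj_conjTranspose (hu' i))
      (fun i => norm_qubitProj_apply_le (hu i)) hr hr1 d S hS ht
      _ (norm_cos_add_sin_smul (hu t) (hu' t) (θ / 2))
      ((norm_cos_add_sin_smul_sub_one_le (hu t) (θ / 2)).trans (by rw [h2]; linarith))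
    have w2 := ih (θ / 2) (by rw [h2]; linarith [abs_nonneg θ])
    convert w1.mul w2 using 1
    ring

/-! ### Product projectors span the Hermitian operators -/

/-- Four imaginary unit quaternions, whose projectors span the one-qubit operators. -/
def axis (k : Fin 4) : ℍ[ℝ] :=
  ![⟨0, 1, 0, 0⟩, ⟨0, -1, 0, 0⟩, ⟨0, 0, 1, 0⟩, ⟨0, 0, 0, 1⟩] k

theorem axis_re (k : Fin 4) : (axis k).re = 0 := by
  fin_cases k <;> rfl

theorem axis_mul_self (k : Fin 4) : axis k * axis k = -1 := by
  have h : (axis k).imI ^ 2 + (axis k).imJ ^ 2 + (axis k).imK ^ 2 = 1 := by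
    fin_cases k <;> simp [axis]
  have h0 := axis_re k
  generalize axis k = u at h h0
  ext
  · rw [Quaternion.re_mul, Quaternion.re_neg, Quaternion.re_one, h0]
    linear_combination -h
  · rw [Quaternion.imI_mul, Quaternion.imI_neg, Quaternion.imI_one, h0]
    ring
  · rw [Quaternion.imJ_mul, Quaternion.imJ_neg, Quaternion.imJ_one, h0]
    ring
  · rw [Quaternion.imK_mul, Quaternion.imK_neg, Quaternion.imK_one, h0]
    ring

theorem star_axis (k : Fin 4) : star (axis k) = -axis k := by
  ext <;> simp [axis_re k]

theorem exists_qubitProj_decomposition (b b' : Bool) : ∃ c : Fin 4 → ℂ, (∀ k, ‖c k‖ ≤ 1) ∧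
    ∀ a a', ∑ k, c k * qubitProj (axis k) a a' = if a = b ∧ a' = b' then 1 else 0 := by
  have hn : ‖-(1 + Complex.I) / 2‖ ≤ 1 := by
    rw [norm_div, norm_neg, Complex.norm_ofNat]
    have := norm_add_le (1 : ℂ) Complex.I
    rw [norm_one, Complex.norm_I] at this
    linarith
  have hn' : ‖-(1 - Complex.I) / 2‖ ≤ 1 := by
    rw [norm_div, norm_neg, Complex.norm_ofNat]
    have := norm_sub_le (1 : ℂ) Complex.I
    rw [norm_one, Complex.norm_I] at this
    linarith
  cases b <;> cases b'
  · refine ⟨![1, 0, 0, 0], fun k => by fin_cases k <;> simp, fun a a' => ?_⟩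
    cases a <;> cases a' <;>
      simp [Fin.sum_univ_four, axis, qubitProj, quatMatrix, Complex.ext_iff] <;> norm_num
  · refine ⟨![-(1 + Complex.I) / 2, -(1 + Complex.I) / 2, Complex.I, 1],
      fun k => by fin_cases k; exacts [hn, hn, by simp, by simp], fun a a' => ?_⟩
    cases a <;> cases a' <;>
      simp [Fin.sum_univ_four, axis, qubitProj, quatMatrix, Complex.ext_iff] <;> norm_num
  · refine ⟨![-(1 - Complex.I) / 2, -(1 - Complex.I) / 2, -Complex.I, 1],
      fun k => by fin_cases k; exacts [hn', hn', by simp, by simp], fun a a' => ?_⟩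
    cases a <;> cases a' <;>
      simp [Fin.sum_univ_four, axis, qubitProj, quatMatrix, Complex.ext_iff] <;> norm_num
  · refine ⟨![0, 1, 0, 0], fun k => by fin_cases k <;> simp, fun a a' => ?_⟩
    cases a <;> cases a' <;>
      simp [Fin.sum_univ_four, axis, qubitProj, quatMatrix, Complex.ext_iff] <;> norm_num

/-- The projector onto the product state whose factors are selected by `a`. -/
noncomputable def stateProj {n : ℕ} (a : Fin n → Fin 4) : Op n :=
  productProj (fun i => axis (a i)) Finset.univ

theorem stateProj_apply {n : ℕ} (a : Fin n → Fin 4) (x y : Bits n) :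
    stateProj a x y = ∏ i, qubitProj (axis (a i)) (x i) (y i) := by
  simp [stateProj, productProj, tensor_apply]

theorem norm_stateProj_apply_le {n : ℕ} (a : Fin n → Fin 4) (x y : Bits n) :
    ‖stateProj a x y‖ ≤ 1 := by
  rw [stateProj_apply, norm_prod]
  exact Finset.prod_le_one (fun _ _ => norm_nonneg _) fun i _ =>
    norm_qubitProj_apply_le (axis_mul_self _) _ _

theorem stateProj_conjTranspose {n : ℕ} (a : Fin n → Fin 4) :
    (stateProj a).conjTranspose = stateProj a := by
  simp [stateProj, productProj, tensor_conjTranspose, qubitProj_conjTranspose (star_axis _)]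

/-- A Hermitian operator is a real combination of projectors onto product states, with
coefficients bounded in terms of its entries. -/
theorem exists_stateProj_decomposition {n : ℕ} {M : Op n} (hM : M.conjTranspose = M) {B : ℝ}
    (hB : ∀ x y, ‖M x y‖ ≤ B) :
    ∃ c : (Fin n → Fin 4) → ℝ, (∀ a, |c a| ≤ 4 ^ n * B) ∧
      M = ∑ a, (c a : ℂ) • stateProj a := by
  choose c hc1 hc using exists_qubitProj_decomposition
  obtain ⟨C, hC⟩ : ∃ C : (Fin n → Fin 4) → ℂ, ∀ a, C a =
      ∑ x : Bits n, ∑ y : Bits n, M x y * ∏ i, c (x i) (y i) (a i) := ⟨_, fun _ => rfl⟩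
  have hsum : M = ∑ a, C a • stateProj a := by
    ext x' y'
    have e1 : ∀ x y : Bits n, ∑ a : Fin n → Fin 4, (∏ i, c (x i) (y i) (a i)) *
        ∏ i, qubitProj (axis (a i)) (x' i) (y' i) = if x = x' ∧ y = y' then 1 else 0 := by
      intro x y
      simp only [← Finset.prod_mul_distrib]
      rw [← Fintype.prod_sum fun i k => c (x i) (y i) k * qubitProj (axis k) (x' i) (y' i)]
      simp only [hc]
      split_ifs with h
      · obtain ⟨rfl, rfl⟩ := h
        simp
      · rw [Finset.prod_eq_zero_iff]
        rw [not_and_or] at h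
        rcases h with h | h
        · obtain ⟨i, hi⟩ := Function.ne_iff.1 h
          exact ⟨i, Finset.mem_univ i, if_neg fun h' => hi h'.1.symm⟩
        · obtain ⟨i, hi⟩ := Function.ne_iff.1 h
          exact ⟨i, Finset.mem_univ i, if_neg fun h' => hi h'.2.symm⟩
    simp only [Matrix.sum_apply, Matrix.smul_apply, smul_eq_mul, hC, stateProj_apply,
      Finset.sum_mul]
    rw [Finset.sum_comm]
    simp only [mul_assoc]
    rw [Finset.sum_congr rfl fun x _ => Finset.sum_comm]
    simp only [← Finset.mul_sum, e1]
    simp [ite_and]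
  refine ⟨fun a => (C a).re, fun a => ?_, ?_⟩
  · refine (Complex.abs_re_le_norm _).trans ?_
    rw [hC]
    refine (norm_sum_le_of_le _ fun x _ => norm_sum_le_of_le _ fun y _ => ?_).trans
      (b := ∑ _x : Bits n, ∑ _y : Bits n, B) (le_of_eq ?_)
    · rw [norm_mul, norm_prod]
      refine (mul_le_of_le_one_right (norm_nonneg _) ?_).trans (hB x y)
      exact Finset.prod_le_one (fun _ _ => norm_nonneg _) fun i _ => hc1 _ _ _
    · simp only [Finset.sum_const, Finset.card_univ, card_bits, nsmul_eq_mul]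
      rw [show (4 : ℝ) = 2 * 2 by norm_num, mul_pow]
      push_cast
      ring
  · -- Average the decomposition with its adjoint.
    have h2 : M = ∑ a, star (C a) • stateProj a := by
      conv_lhs => rw [← hM, hsum]
      simp only [Matrix.conjTranspose_sum, Matrix.conjTranspose_smul, stateProj_conjTranspose]
    have h3 : M = (1 / 2 : ℂ) • (M + M) := by
      rw [← two_smul ℂ M, smul_smul]; norm_num
    rw [h3]
    nth_rewrite 1 [hsum]
    nth_rewrite 1 [h2]
    rw [← Finset.sum_add_distrib, Finset.smul_sum]
    refine Finset.sum_congr rfl fun a _ => ?_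
    rw [← add_smul, smul_smul]
    congr 1
    rw [Complex.star_def, Complex.add_conj]
    push_cast
    ring

/-! ### Paths of states -/

/-- `L` two-local unitaries take `v` to `w` through states in `good`. -/
def Connects {n : ℕ} (good : Set (Qubits n)) (L : ℕ) (v w : Qubits n) : Prop :=
  ∃ Us : List (Op n), Us.length = L ∧
    (∀ U ∈ Us, U ∈ Matrix.unitaryGroup (Bits n) ℂ ∧ IsLocal 2 U) ∧ run Us v = w ∧
    ∀ i ≤ L, run (Us.take i) v ∈ good

namespace Connects

variable {n : ℕ} {good good' : Set (Qubits n)} {K L : ℕ} {u v w : Qubits n}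

theorem refl (hv : v ∈ good) : Connects good 0 v v :=
  ⟨[], rfl, by simp, rfl, fun _ _ => by simpa using hv⟩

theorem mono (h : Connects good L v w) (hg : good ⊆ good') : Connects good' L v w := by
  obtain ⟨Us, h1, h2, h3, h4⟩ := h
  exact ⟨Us, h1, h2, h3, fun i hi => hg (h4 i hi)⟩

theorem trans (h : Connects good K u v) (h' : Connects good L v w) :
    Connects good (K + L) u w := by
  obtain ⟨Us, rfl, h2, rfl, h4⟩ := h
  obtain ⟨Vs, rfl, k2, rfl, k4⟩ := h'
  refine ⟨Us ++ Vs, List.length_append, fun W hW => ?_, run_append _ _ _, fun i hi => ?_⟩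
  · rcases List.mem_append.1 hW with h | h
    · exact h2 W h
    · exact k2 W h
  · rw [List.take_append, run_append]
    rcases le_total i Us.length with h | h
    · rw [Nat.sub_eq_zero_of_le h]
      simpa using h4 i h
    · rw [List.take_of_length_le h]
      exact k4 _ (by omega)

theorem norm_eq (h : Connects good L v w) : ‖w‖ = ‖v‖ := by
  obtain ⟨Us, -, h2, rfl, -⟩ := h
  exact norm_run (fun U hU => (h2 U hU).1) v

/-- Waiting, by applying the identity. -/
theorem wait (hv : v ∈ good) (L : ℕ) : Connects good L v v := by
  have h : ∀ k, run (List.replicate k (1 : Op n)) v = v := fun k => by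
    induction k with
    | zero => rfl
    | succ k ih => rw [List.replicate_succ, run_cons, toEuclideanLin_one_apply, ih]
  refine ⟨List.replicate L 1, by simp, fun U hU => ?_, h L, fun i _ => ?_⟩
  · rw [List.eq_of_mem_replicate hU]
    refine ⟨one_mem _, ?_⟩
    simpa using isLocal_smul_one (n := n) 2 1
  · rw [List.take_replicate, h]
    exact hv

end Connects

theorem IsWord.norm_eq {n : ℕ} {r : ℝ} {L : ℕ} {U : Op n} (h : IsWord r L U) (v : Qubits n) :
    ‖Matrix.toEuclideanLin U v‖ = ‖v‖ := by
  obtain ⟨Us, -, h2, h3⟩ := h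
  rw [← h3, norm_run fun V hV => (h2 V hV).unitary]

theorem norm_run_sub_run {n : ℕ} {Us : List (Op n)}
    (h : ∀ U ∈ Us, ∀ v, ‖Matrix.toEuclideanLin U v‖ = ‖v‖) (v w : Qubits n) :
    ‖run Us v - run Us w‖ = ‖v - w‖ := by
  induction Us generalizing v w with
  | nil => rfl
  | cons U Us ih =>
    rw [run_cons, run_cons, ih fun V hV => h V (List.mem_cons_of_mem _ hV), ← map_sub,
      h U List.mem_cons_self]

theorem IsWord.connects {n : ℕ} {r : ℝ} (hr : 0 ≤ r) {L : ℕ} {U : Op n} (h : IsWord r L U)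
    {v : Qubits n} (hv : ‖v‖ = 1) :
    Connects (Metric.closedBall v (L * (4 ^ n * r))) L v (Matrix.toEuclideanLin U v) := by
  obtain ⟨Us, rfl, h2, h3⟩ := h
  refine ⟨Us, rfl, fun V hV => ⟨(h2 V hV).unitary, (h2 V hV).local_two⟩, h3 v, fun i hi => ?_⟩
  have := norm_run_sub_le (fun V hV => h2 V (List.mem_of_mem_take hV)) v (Us := Us.take i)
  rw [hv, mul_one, List.length_take_of_le hi] at this
  rw [mem_closedBall_iff_norm]
  exact this.trans (mul_le_mul_of_nonneg_right (by exact_mod_cast hi) (by positivity))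

/-- Running words that each move a state by at most `t`. -/
theorem connects_run_words {n : ℕ} {α : Type*} {r : ℝ} (hr : 0 ≤ r) {K : ℕ} {U : α → Op n}
    (hU : ∀ a, IsWord r K (U a)) {t : ℝ}
    (ht : ∀ a v, ‖Matrix.toEuclideanLin (U a) v - v‖ ≤ t * ‖v‖) (l : List α) {v₀ v : Qubits n}
    (hv : ‖v‖ = 1) {δ : ℝ} (hδ : ‖v - v₀‖ ≤ δ) :
    Connects (Metric.closedBall v₀ (δ + l.length * t + K * (4 ^ n * r))) (l.length * K) v
      (run (l.map U) v) := by
  induction l generalizing v δ with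
  | nil =>
    rw [List.length_nil, zero_mul]
    refine Connects.refl ?_
    rw [mem_closedBall_iff_norm]
    have : 0 ≤ (K : ℝ) * (4 ^ n * r) := by positivity
    simpa using hδ.trans (by linarith)
  | cons a l ih =>
    have h1 := (hU a).connects hr hv
    have ht0 : 0 ≤ t := by
      have := (norm_nonneg _).trans (ht a v)
      rwa [hv, mul_one] at this
    have h2 : ‖Matrix.toEuclideanLin (U a) v - v₀‖ ≤ δ + t := by
      have := ht a v
      rw [hv, mul_one] at this
      calc _ ≤ _ := norm_sub_le_norm_sub_add_norm_sub _ v _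
        _ ≤ _ := by linarith
    have h3 := ih (h1.norm_eq.trans hv) h2
    rw [List.map_cons, run_cons, List.length_cons, add_mul, one_mul, add_comm _ K]
    refine (h1.mono fun w hw => ?_).trans (h3.mono (Metric.closedBall_subset_closedBall ?_))
    · rw [mem_closedBall_iff_norm] at hw ⊢
      have : 0 ≤ ((l.length + 1 : ℕ) : ℝ) * t := by positivity
      calc _ ≤ _ := norm_sub_le_norm_sub_add_norm_sub _ v _
        _ ≤ _ := by linarith
    · push_cast
      linarith

/-- The first-order product formula: a product of unitaries `U a`, each equal to `1 + X a` up to an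
error quadratic in the size `t`, agrees with `1 + ∑ X a` up to an error quadratic in the total
size. -/
theorem norm_run_sub_sub_sum_le {n : ℕ} {α : Type*} {U : α → Op n}
    (hU : ∀ a v, ‖Matrix.toEuclideanLin (U a) v‖ = ‖v‖) {X : α → Qubits n →ₗ[ℂ] Qubits n} {t : ℝ}
    (ht : ∀ a v, ‖Matrix.toEuclideanLin (U a) v - v‖ ≤ t * ‖v‖)
    (hX : ∀ a v, ‖X a v‖ ≤ t * ‖v‖)
    (hUX : ∀ a v, ‖Matrix.toEuclideanLin (U a) v - v - X a v‖ ≤ t ^ 2 * ‖v‖) (ht0 : 0 ≤ t)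
    (l : List α) (v : Qubits n) :
    ‖run (l.map U) v - v - (l.map fun a => X a v).sum‖ ≤ (l.length * t) ^ 2 * ‖v‖ := by
  induction l generalizing v with
  | nil => simp
  | cons a l ih =>
    obtain ⟨w, hw⟩ : ∃ w, w = Matrix.toEuclideanLin (U a) v := ⟨_, rfl⟩
    have h1 := ih w
    have h2 : ‖(l.map fun b => X b (w - v)).sum‖ ≤ l.length * t * ‖w - v‖ := by
      clear ih h1
      induction l with
      | nil => simp
      | cons b l ih =>
        rw [List.map_cons, List.sum_cons, List.length_cons]
        refine (norm_add_le _ _).trans ((add_le_add (hX b _) ih).trans (le_of_eq ?_))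
        push_cast
        ring
    have h3 : ‖w - v‖ ≤ t * ‖v‖ := by rw [hw]; exact ht a v
    have h4 : ‖w - v - X a v‖ ≤ t ^ 2 * ‖v‖ := by rw [hw]; exact hUX a v
    have h5 : ‖w‖ = ‖v‖ := by rw [hw]; exact hU a v
    have h6 : (l.map fun b => X b (w - v)).sum =
        (l.map fun b => X b w).sum - (l.map fun b => X b v).sum := by
      clear ih h1 h2
      induction l with
      | nil => simp
      | cons b l ih =>
        simp only [List.map_cons, List.sum_cons]
        rw [ih, map_sub]
        abel
    have h7 : run ((a :: l).map U) v - v - ((a :: l).map fun b => X b v).sum =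
        (run (l.map U) w - w - (l.map fun b => X b w).sum) +
          (l.map fun b => X b (w - v)).sum + (w - v - X a v) := by
      rw [List.map_cons, run_cons, List.map_cons, List.sum_cons, h6, hw]
      abel
    rw [h5] at h1
    rw [h7]
    refine (norm_add₃_le).trans ?_
    have h8 : (l.length : ℝ) * t * ‖w - v‖ ≤ l.length * t * (t * ‖v‖) :=
      mul_le_mul_of_nonneg_left h3 (by positivity)
    rw [List.length_cons]
    push_cast
    have h9 : 0 ≤ (l.length : ℝ) * (t ^ 2 * ‖v‖) := by positivity
    nlinarith

/-! ### Following a great circle -/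

section Arc

variable {n : ℕ}

/-- The point at angle `θ` on the great circle from `ψ` in the direction of `u`. -/
noncomputable def arc (ψ u : Qubits n) (θ : ℝ) : Qubits n :=
  (Real.cos θ : ℂ) • ψ + (Real.sin θ : ℂ) • u

/-- The anti-Hermitian operator `|u⟩⟨ψ| - |ψ⟩⟨u|`, which generates the rotation along `arc`. -/
def arcGenerator (ψ u : Qubits n) : Op n :=
  Matrix.vecMulVec u.ofLp (star ψ.ofLp) - Matrix.vecMulVec ψ.ofLp (star u.ofLp)

theorem toEuclideanLin_vecMulVec (a b v : Qubits n) :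
    Matrix.toEuclideanLin (Matrix.vecMulVec a.ofLp (star b.ofLp)) v = inner ℂ b v • a := by
  ext x
  rw [Matrix.ofLp_toLpLin, Matrix.toLin'_apply, Matrix.vecMulVec_mulVec, PiLp.smul_apply,
    EuclideanSpace.inner_eq_star_dotProduct, dotProduct_comm]
  simp [mul_comm]

theorem toEuclideanLin_arcGenerator (ψ u v : Qubits n) :
    Matrix.toEuclideanLin (arcGenerator ψ u) v = inner ℂ ψ v • u - inner ℂ u v • ψ := by
  rw [arcGenerator, map_sub, LinearMap.sub_apply, toEuclideanLin_vecMulVec,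
    toEuclideanLin_vecMulVec]

theorem arcGenerator_conjTranspose (ψ u : Qubits n) :
    (arcGenerator ψ u).conjTranspose = -arcGenerator ψ u := by
  simp [arcGenerator, Matrix.conjTranspose_sub, Matrix.conjTranspose_vecMulVec]

theorem norm_arcGenerator_apply_le {ψ u : Qubits n} (hψ : ‖ψ‖ = 1) (hu : ‖u‖ = 1) (x y : Bits n) :
    ‖arcGenerator ψ u x y‖ ≤ 2 := by
  have h : ∀ a b : Qubits n, ‖a‖ = 1 → ‖b‖ = 1 →
      ‖Matrix.vecMulVec a.ofLp (star b.ofLp) x y‖ ≤ 1 := fun a b ha hb => by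
    rw [Matrix.vecMulVec_apply, norm_mul, Pi.star_apply, norm_star]
    exact mul_le_one₀ (ha ▸ PiLp.norm_apply_le a x) (norm_nonneg _) (hb ▸ PiLp.norm_apply_le b y)
  rw [arcGenerator, Matrix.sub_apply]
  exact (norm_sub_le _ _).trans (by linarith [h u ψ hu hψ, h ψ u hψ hu])

theorem arc_add {ψ u : Qubits n} (hψ : ‖ψ‖ = 1) (hu : ‖u‖ = 1) (h : inner ℂ ψ u = 0)
    (θ ε : ℝ) : arc ψ u (θ + ε) = (Real.cos ε : ℂ) • arc ψ u θ +
      (Real.sin ε : ℂ) • Matrix.toEuclideanLin (arcGenerator ψ u) (arc ψ u θ) := by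
  have h' : inner ℂ u ψ = 0 := inner_eq_zero_symm.1 h
  have h1 : inner ℂ ψ (arc ψ u θ) = (Real.cos θ : ℂ) := by
    rw [arc, inner_add_right, inner_smul_right, inner_smul_right, h, inner_self_eq_norm_sq_to_K, hψ]
    simp
  have h2 : inner ℂ u (arc ψ u θ) = (Real.sin θ : ℂ) := by
    rw [arc, inner_add_right, inner_smul_right, inner_smul_right, h', inner_self_eq_norm_sq_to_K,
      hu]
    simp
  rw [toEuclideanLin_arcGenerator, h1, h2, arc, arc, Real.cos_add, Real.sin_add]
  push_cast
  module

theorem norm_arc {ψ u : Qubits n} (hψ : ‖ψ‖ = 1) (hu : ‖u‖ = 1) (h : inner ℂ ψ u = 0)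
    (θ : ℝ) : ‖arc ψ u θ‖ = 1 := by
  have h1 : ‖arc ψ u θ‖ * ‖arc ψ u θ‖ = 1 := by
    rw [arc, norm_add_sq_eq_norm_sq_add_norm_sq_of_inner_eq_zero (𝕜 := ℂ), norm_smul, norm_smul, hψ, hu,
      Complex.norm_real, Complex.norm_real, Real.norm_eq_abs, Real.norm_eq_abs, mul_one, mul_one,
      abs_mul_abs_self, abs_mul_abs_self, ← sq, ← sq, Real.cos_sq_add_sin_sq]
    rw [inner_smul_left, inner_smul_right, h, mul_zero, mul_zero]
  nlinarith [norm_nonneg (arc ψ u θ)]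

theorem norm_arc_add_sub_le {ψ u : Qubits n} (hψ : ‖ψ‖ = 1) (hu : ‖u‖ = 1) (h : inner ℂ ψ u = 0)
    (θ : ℝ) {ε : ℝ} (hε : 0 ≤ ε) (hε1 : ε ≤ 1) :
    ‖arc ψ u (θ + ε) - arc ψ u θ -
      (ε : ℂ) • Matrix.toEuclideanLin (arcGenerator ψ u) (arc ψ u θ)‖ ≤ ε ^ 2 := by
  obtain ⟨g, hg⟩ : ∃ g, g = Matrix.toEuclideanLin (arcGenerator ψ u) (arc ψ u θ) := ⟨_, rfl⟩
  -- The derivative is the arc a quarter turn further.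
  have hg1 : ‖g‖ = 1 := by
    have := arc_add hψ hu h θ (Real.pi / 2)
    rw [Real.cos_pi_div_two, Real.sin_pi_div_two, ← hg] at this
    simp only [Complex.ofReal_zero, zero_smul, Complex.ofReal_one, one_smul, zero_add] at this
    rw [← this, norm_arc hψ hu h]
  have e : arc ψ u (θ + ε) - arc ψ u θ - (ε : ℂ) • g =
      ((Real.cos ε - 1 : ℝ) : ℂ) • arc ψ u θ + ((Real.sin ε - ε : ℝ) : ℂ) • g := by
    rw [arc_add hψ hu h, ← hg]
    push_cast
    module
  have h1 : |Real.cos ε - 1| ≤ ε ^ 2 / 2 := by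
    rw [abs_le]
    constructor <;> linarith [Real.one_sub_sq_div_two_le_cos (x := ε), Real.cos_le_one ε,
      sq_nonneg ε]
  have h2 : |Real.sin ε - ε| ≤ ε ^ 2 / 2 := by
    rcases hε.eq_or_lt with rfl | h0
    · simp
    · rw [abs_le]
      constructor
      · have := Real.sin_gt_sub_cube h0
        nlinarith [mul_nonneg (sq_nonneg ε) (sub_nonneg.2 hε1)]
      · linarith [Real.sin_le hε, sq_nonneg ε]
  rw [← hg, e]
  refine (norm_add_le _ _).trans ?_
  rw [norm_smul, norm_smul, norm_arc hψ hu h, hg1, Complex.norm_real, Complex.norm_real,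
    Real.norm_eq_abs, Real.norm_eq_abs]
  linarith

/-- One step along a great circle by a product formula over all product projectors. Here `s` bounds
the sum of the distances to the identity of the `4 ^ n` factors, and the last summand of the radius
accounts for the gates within a factor. -/
theorem exists_connects_arc_step {ψ u : Qubits n} (hψ : ‖ψ‖ = 1) (hu : ‖u‖ = 1)
    (h : inner ℂ ψ u = 0) {d : ℕ} (hd : n ≤ 2 ^ d) {r : ℝ} (hr : 0 < r) (hr1 : r ≤ 1) {ε : ℝ}
    (hε : 0 ≤ ε) (hεr : ε * (4 ^ n * 2) ≤ 16 * (r / 16) ^ 2 ^ d) {s : ℝ} (hs : s = 2 * 64 ^ n * ε)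
    {v : Qubits n} (hv : ‖v‖ = 1) {θ δ : ℝ} (hδ : ‖v - arc ψ u θ‖ ≤ δ) :
    ∃ w, Connects (Metric.closedBall (arc ψ u θ) (δ + s + ((n * 4 ^ d + 1 : ℕ) : ℝ) * (4 ^ n * r)))
        (4 ^ n * (n * 4 ^ d + 1)) v w ∧ ‖w - arc ψ u (θ + ε)‖ ≤ δ + 2 * s ^ 2 := by
  obtain ⟨c, hc, hM⟩ := exists_stateProj_decomposition
    (M := (-Complex.I) • arcGenerator ψ u)
    (by rw [Matrix.conjTranspose_smul, arcGenerator_conjTranspose]; simp)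
    (B := 2) (fun x y => by
      rw [Matrix.smul_apply, norm_smul, norm_neg, Complex.norm_I, one_mul]
      exact norm_arcGenerator_apply_le hψ hu x y)
  have h4 : (1 : ℝ) ≤ 4 ^ n := one_le_pow₀ (by norm_num)
  have hτ1 : ε * (4 ^ n * 2) ≤ 1 := by
    refine hεr.trans ?_
    have : (r / 16) ^ 2 ^ d ≤ r / 16 :=
      pow_le_of_le_one (by positivity) (by linarith) (by positivity)
    linarith
  have hε1 : ε ≤ 1 := by nlinarith
  obtain ⟨τ, hτ⟩ : ∃ τ, τ = ε * (4 ^ n * 2) := ⟨_, rfl⟩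
  rw [← hτ] at hεr hτ1
  have hτ0 : 0 ≤ τ := by rw [hτ]; positivity
  obtain ⟨ω, hω⟩ : ∃ ω : (Fin n → Fin 4) → ℝ, ∀ a, ω a = ε * c a := ⟨_, fun _ => rfl⟩
  have hωτ : ∀ a, |ω a| ≤ τ := fun a => by
    rw [hω, abs_mul, abs_of_nonneg hε, hτ]
    exact mul_le_mul_of_nonneg_left (hc a) hε
  obtain ⟨U, hU⟩ : ∃ U : (Fin n → Fin 4) → Op n,
      ∀ a, U a = phase (fun i => axis (a i)) Finset.univ (ω a) := ⟨_, fun _ => rfl⟩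
  have hword : ∀ a, IsWord r (n * 4 ^ d + 1) (U a) := fun a => by
    have := isWord_phase (u := fun i => axis (a i)) (fun i => axis_mul_self _)
      (fun i => star_axis _) hr hr1 hd Finset.univ (ω a) ((hωτ a).trans hεr)
    rwa [← hU, Finset.card_univ, Fintype.card_fin] at this
  have hUv : ∀ a v, Matrix.toEuclideanLin (U a) v - v = (Complex.exp (Complex.I * ω a) - 1) •
      Matrix.toEuclideanLin (stateProj a) v := fun a v => by
    rw [hU, phase, map_add, LinearMap.add_apply, toEuclideanLin_one_apply, map_smul,
      LinearMap.smul_apply, add_sub_cancel_left, stateProj]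
  have hP : ∀ a v, ‖Matrix.toEuclideanLin (stateProj a) v‖ ≤ 4 ^ n * ‖v‖ := fun a v => by
    simpa using norm_toEuclideanLin_le (norm_stateProj_apply_le a) v
  obtain ⟨t, ht⟩ : ∃ t, t = 4 ^ n * τ := ⟨_, rfl⟩
  have ht0 : 0 ≤ t := by rw [ht]; positivity
  have hscale : ∀ (z : ℂ) (b : ℝ) (a : Fin n → Fin 4) (v : Qubits n), ‖z‖ ≤ b →
      ‖z • Matrix.toEuclideanLin (stateProj a) v‖ ≤ 4 ^ n * b * ‖v‖ := fun z b a v hz => by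
    rw [norm_smul]
    calc _ ≤ b * (4 ^ n * ‖v‖) := mul_le_mul hz (hP a v) (norm_nonneg _) ((norm_nonneg _).trans hz)
      _ = _ := by ring
  have hmove : ∀ a v, ‖Matrix.toEuclideanLin (U a) v - v‖ ≤ t * ‖v‖ := fun a v => by
    rw [hUv, ht]
    exact hscale _ _ a v ((norm_exp_sub_one_le _).trans (hωτ a))
  obtain ⟨X, hX⟩ : ∃ X : (Fin n → Fin 4) → Qubits n →ₗ[ℂ] Qubits n,
      ∀ a v, X a v = (Complex.I * ω a) • Matrix.toEuclideanLin (stateProj a) v :=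
    ⟨fun a => (Complex.I * ω a) • Matrix.toEuclideanLin (stateProj a), fun _ _ => rfl⟩
  have hIω : ∀ a, ‖Complex.I * ω a‖ ≤ τ := fun a => by
    rw [norm_mul, Complex.norm_I, one_mul, Complex.norm_real]
    exact hωτ a
  have hXt : ∀ a v, ‖X a v‖ ≤ t * ‖v‖ := fun a v => by
    rw [hX, ht]
    exact hscale _ _ a v (hIω a)
  have hUX : ∀ a v, ‖Matrix.toEuclideanLin (U a) v - v - X a v‖ ≤ t ^ 2 * ‖v‖ := fun a v => by
    rw [hUv, hX, ← sub_smul]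
    refine (hscale _ (τ ^ 2) a v ?_).trans ?_
    · refine (Complex.norm_exp_sub_one_sub_id_le ((hIω a).trans hτ1)).trans ?_
      exact pow_le_pow_left₀ (norm_nonneg _) (hIω a) 2
    · refine mul_le_mul_of_nonneg_right ?_ (norm_nonneg _)
      rw [ht, mul_pow]
      exact mul_le_mul_of_nonneg_right (by nlinarith) (sq_nonneg τ)
  obtain ⟨l, hl⟩ : ∃ l, l = (Finset.univ : Finset (Fin n → Fin 4)).toList := ⟨_, rfl⟩
  have hlen : l.length = 4 ^ n := by
    rw [hl, Finset.length_toList, Finset.card_univ]; simp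
  have hst : (l.length : ℝ) * t = s := by
    rw [hlen, ht, hτ, hs, show (64 : ℝ) = 4 * 4 * 4 by norm_num, mul_pow, mul_pow]
    push_cast
    ring
  have hsum : ∀ v, (l.map fun a => X a v).sum =
      (ε : ℂ) • Matrix.toEuclideanLin (arcGenerator ψ u) v := fun v => by
    have hgen : arcGenerator ψ u = Complex.I • ∑ a, (c a : ℂ) • stateProj a := by
      rw [← hM, smul_smul]; simp
    rw [hl, Finset.sum_map_toList, hgen, map_smul, LinearMap.smul_apply, map_sum,
      LinearMap.sum_apply, Finset.smul_sum, Finset.smul_sum]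
    refine Finset.sum_congr rfl fun a _ => ?_
    rw [hX, hω, map_smul, LinearMap.smul_apply, smul_smul, smul_smul]
    congr 1
    push_cast
    ring
  have hisom : ∀ V ∈ l.map U, ∀ v, ‖Matrix.toEuclideanLin V v‖ = ‖v‖ := fun V hV v => by
    obtain ⟨a, -, rfl⟩ := List.mem_map.1 hV
    exact (hword a).norm_eq v
  refine ⟨run (l.map U) v, ?_, ?_⟩
  · have := connects_run_words hr.le hword hmove l hv hδ
    rwa [hst, hlen] at this
  · have e1 := norm_run_sub_run hisom v (arc ψ u θ)
    have e2 := norm_run_sub_sub_sum_le (fun a => (hword a).norm_eq) hmove hXt hUX ht0 l (arc ψ u θ)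
    rw [hst, hsum, norm_arc hψ hu h, mul_one] at e2
    have e3 := norm_arc_add_sub_le hψ hu h θ hε hε1
    have hεs : ε ^ 2 ≤ s ^ 2 := by
      refine pow_le_pow_left₀ hε ?_ 2
      have : (1 : ℝ) ≤ 64 ^ n := one_le_pow₀ (by norm_num)
      rw [hs]
      nlinarith
    have e4 : run (l.map U) v - arc ψ u (θ + ε) =
        (run (l.map U) v - run (l.map U) (arc ψ u θ)) +
        (run (l.map U) (arc ψ u θ) - arc ψ u θ -
          (ε : ℂ) • Matrix.toEuclideanLin (arcGenerator ψ u) (arc ψ u θ)) -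
        (arc ψ u (θ + ε) - arc ψ u θ -
          (ε : ℂ) • Matrix.toEuclideanLin (arcGenerator ψ u) (arc ψ u θ)) := by abel
    rw [e4]
    refine (norm_sub_le _ _).trans ((add_le_add (norm_add_le _ _) e3).trans ?_)
    rw [e1]
    linarith

/-- Iterating the step of length `ε`: the errors of at most `T` steps add up, as the gates are
isometries. -/
theorem exists_connects_arc {ψ u : Qubits n} (hψ : ‖ψ‖ = 1) (hu : ‖u‖ = 1)
    (h : inner ℂ ψ u = 0) {d : ℕ} (hd : n ≤ 2 ^ d) {r : ℝ} (hr : 0 < r) (hr1 : r ≤ 1) {ε : ℝ}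
    (hε : 0 ≤ ε) (hεr : ε * (4 ^ n * 2) ≤ 16 * (r / 16) ^ 2 ^ d) {s : ℝ} (hs : s = 2 * 64 ^ n * ε)
    {T : ℕ} {η : ℝ} (hη : T * (2 * s ^ 2) + s + ((n * 4 ^ d + 1 : ℕ) : ℝ) * (4 ^ n * r) ≤ η)
    (k : ℕ) (hk : k ≤ T) :
    ∃ w, Connects {v | ∃ θ, 0 ≤ θ ∧ θ ≤ T * ε ∧ ‖v - arc ψ u θ‖ ≤ η}
        (k * (4 ^ n * (n * 4 ^ d + 1))) ψ w ∧ ‖w - arc ψ u (k * ε)‖ ≤ k * (2 * s ^ 2) := by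
  have hs0 : 0 ≤ s := by rw [hs]; positivity
  have hr0 : 0 ≤ ((n * 4 ^ d + 1 : ℕ) : ℝ) * (4 ^ n * r) := by positivity
  induction k with
  | zero =>
    have h0 : arc ψ u 0 = ψ := by simp [arc]
    refine ⟨ψ, ?_, by simp [h0]⟩
    rw [zero_mul]
    refine Connects.refl ⟨0, le_rfl, by positivity, ?_⟩
    have : 0 ≤ (T : ℝ) * (2 * s ^ 2) := by positivity
    rw [h0, sub_self, norm_zero]
    linarith
  | succ k ih =>
    obtain ⟨w, hw, hwk⟩ := ih (by omega)
    obtain ⟨w', hw', hwk'⟩ := exists_connects_arc_step hψ hu h hd hr hr1 hε hεr hs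
      (hw.norm_eq.trans hψ) hwk
    have hkT : (k : ℝ) ≤ T := by exact_mod_cast (by omega : k ≤ T)
    refine ⟨w', ?_, ?_⟩
    · rw [add_mul, one_mul]
      refine hw.trans (hw'.mono fun v hv => ⟨k * ε, by positivity,
        mul_le_mul_of_nonneg_right hkT hε, ?_⟩)
      rw [mem_closedBall_iff_norm] at hv
      have := mul_le_mul_of_nonneg_right hkT (by positivity : 0 ≤ 2 * s ^ 2)
      linarith
    · push_cast
      rw [add_mul, one_mul, add_mul, one_mul]
      exact hwk'

end Arc

/-! ### Counting the gates -/

/-- `logLength n h` is the binary logarithm of a number of gates that suffices to follow an arc on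
`n` qubits up to an error `2 ^ (-h)`. -/
def logLength (n h : ℕ) : ℕ := h + 9 + 12 * n + (h + 5 * n + 9) * (2 * n) + 5 * n + 3

theorem two_pow_mul_half_pow_le {a b c : ℕ} (h : a + b ≤ c) :
    (2 : ℝ) ^ a * (1 / 2) ^ c ≤ (1 / 2) ^ b := by
  obtain ⟨k, rfl⟩ := Nat.exists_eq_add_of_le h
  have h1 : (2 : ℝ) ^ a * (1 / 2) ^ a = 1 := by rw [← mul_pow]; norm_num
  have h2 : (1 / 2 : ℝ) ^ k ≤ 1 := pow_le_one₀ (by norm_num) (by norm_num)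
  calc (2 : ℝ) ^ a * (1 / 2) ^ (a + b + k)
      = (2 ^ a * (1 / 2) ^ a) * (1 / 2) ^ b * (1 / 2) ^ k := by ring
    _ ≤ 1 * (1 / 2) ^ b * 1 := by
        rw [h1]; exact mul_le_mul_of_nonneg_left h2 (by positivity)
    _ = _ := by ring

theorem gate_count_le {n d : ℕ} (hd : 2 ^ d ≤ 2 * n) : n * 4 ^ d + 1 ≤ 2 ^ (3 * n + 3) := by
  have h1 : n < 2 ^ n := Nat.lt_two_pow_self
  have h2 : (4 : ℕ) ^ d ≤ (2 * n) ^ 2 := by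
    calc (4 : ℕ) ^ d = (2 ^ d) ^ 2 := by rw [← pow_mul, mul_comm, pow_mul]; norm_num
      _ ≤ _ := Nat.pow_le_pow_left hd 2
  calc n * 4 ^ d + 1 ≤ n * (2 * n) ^ 2 + 1 := by gcongr
    _ = 4 * n ^ 3 + 1 := by ring
    _ ≤ 4 * (2 ^ n) ^ 3 + 1 * (2 ^ n) ^ 3 := by
        have h3 : n ^ 3 ≤ (2 ^ n) ^ 3 := Nat.pow_le_pow_left h1.le 3
        have h4 : 1 ≤ (2 ^ n) ^ 3 := Nat.one_le_pow _ _ (Nat.two_pow_pos n)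
        omega
    _ ≤ 2 ^ (3 * n + 3) := by
        rw [← add_mul, pow_add, ← pow_mul, mul_comm n 3, mul_comm]
        gcongr
        norm_num

/-- Exponentially many two-local unitaries follow an arc to within an exponentially small
distance. -/
theorem exists_connects_arc_end {n : ℕ} (hn : 1 ≤ n) {ψ u : Qubits n} (hψ : ‖ψ‖ = 1)
    (hu : ‖u‖ = 1) (h0 : inner ℂ ψ u = 0) {l : ℝ} (hl : 0 ≤ l) (hl4 : l ≤ 4) (h : ℕ) :
    ∃ L ≤ 2 ^ logLength n h, ∃ w,
      Connects {v | ∃ θ, 0 ≤ θ ∧ θ ≤ l ∧ ‖v - arc ψ u θ‖ ≤ (1 / 2) ^ h} L ψ w ∧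
      ‖w - arc ψ u l‖ ≤ (1 / 2) ^ h := by
  -- A control set has at most `2 ^ d` qubits.
  obtain ⟨d, hd, hd2⟩ : ∃ d, n ≤ 2 ^ d ∧ 2 ^ d ≤ 2 * n := by
    refine ⟨Nat.clog 2 n, Nat.le_pow_clog (by norm_num) n, ?_⟩
    rcases hn.eq_or_lt with rfl | hn
    · simp
    · have h1 := Nat.pow_pred_clog_lt_self (b := 2) (by norm_num) hn
      have h2 : 0 < Nat.clog 2 n := Nat.clog_pos (by norm_num) hn
      obtain ⟨k, hk⟩ : ∃ k, Nat.clog 2 n = k + 1 := ⟨_, (Nat.succ_pred_eq_of_pos h2).symm⟩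
      rw [hk, Nat.pred_succ] at h1
      rw [hk, pow_succ]
      omega
  -- The gates are `2 ^ (-ρ)`-close to the identity, and the arc is divided into `2 ^ A` steps.
  obtain ⟨ρ, hρ⟩ : ∃ ρ, ρ = h + 5 * n + 5 := ⟨_, rfl⟩
  obtain ⟨A, hA⟩ : ∃ A, A = h + 9 + 12 * n + (h + 5 * n + 9) * (2 * n) := ⟨_, rfl⟩
  have hTx : (2 : ℝ) ^ A * (1 / 2) ^ A = 1 := by rw [← mul_pow]; norm_num
  obtain ⟨ε, hε⟩ : ∃ ε : ℝ, ε = l * (1 / 2) ^ A := ⟨_, rfl⟩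
  have hε0 : 0 ≤ ε := by rw [hε]; positivity
  have hε4 : ε ≤ 4 * (1 / 2) ^ A := by
    rw [hε]; exact mul_le_mul_of_nonneg_right hl4 (by positivity)
  obtain ⟨s, hs⟩ : ∃ s : ℝ, s = 2 * 64 ^ n * ε := ⟨_, rfl⟩
  have hs0 : 0 ≤ s := by rw [hs]; positivity
  have hs1 : s ≤ 2 ^ (6 * n + 3) * (1 / 2) ^ A := by
    rw [hs, pow_add, pow_mul]
    norm_num at hε4 ⊢
    nlinarith [mul_le_mul_of_nonneg_left hε4 (by positivity : (0 : ℝ) ≤ 2 * 64 ^ n)]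
  have hTe : ((2 ^ A : ℕ) : ℝ) * ε = l := by
    push_cast
    rw [hε]
    linear_combination l * hTx
  have hstep : ε * (4 ^ n * 2) ≤ 16 * ((1 / 2 : ℝ) ^ ρ / 16) ^ 2 ^ d := by
    have e1 : (1 / 2 : ℝ) ^ ρ / 16 = (1 / 2) ^ (ρ + 4) := by rw [pow_add]; norm_num; ring
    have e2 : (2 : ℝ) ^ (2 * n + 3) * (1 / 2) ^ A ≤ (1 / 2) ^ ((ρ + 4) * 2 ^ d) := by
      refine two_pow_mul_half_pow_le ?_
      have := Nat.mul_le_mul_left (ρ + 4) hd2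
      rw [show ρ + 4 = h + 5 * n + 9 by omega] at this ⊢
      rw [hA]
      omega
    rw [e1, ← pow_mul]
    have e3 : ε * (4 ^ n * 2) ≤ 2 ^ (2 * n + 3) * (1 / 2) ^ A := by
      rw [pow_add, pow_mul]
      norm_num at hε4 ⊢
      nlinarith [mul_le_mul_of_nonneg_right hε4 (by positivity : (0 : ℝ) ≤ 4 ^ n * 2)]
    have e4 : (0 : ℝ) ≤ (1 / 2) ^ ((ρ + 4) * 2 ^ d) := by positivity
    linarith
  have hη : ((2 ^ A : ℕ) : ℝ) * (2 * s ^ 2) + s +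
      ((n * 4 ^ d + 1 : ℕ) : ℝ) * (4 ^ n * (1 / 2) ^ ρ) ≤ (1 / 2) ^ h := by
    have e1 : ((2 ^ A : ℕ) : ℝ) * (2 * s ^ 2) ≤ (1 / 2) ^ (h + 2) := by
      have := pow_le_pow_left₀ hs0 hs1 2
      calc ((2 ^ A : ℕ) : ℝ) * (2 * s ^ 2)
          ≤ 2 ^ A * (2 * (2 ^ (6 * n + 3) * (1 / 2) ^ A) ^ 2) := by
            push_cast; gcongr
        _ = (2 ^ A * (1 / 2) ^ A) * (2 ^ (12 * n + 7) * (1 / 2) ^ A) := by ring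
        _ ≤ _ := by
            rw [hTx, one_mul]
            exact two_pow_mul_half_pow_le (by rw [hA]; omega)
    have e2 : s ≤ (1 / 2) ^ (h + 2) :=
      hs1.trans (two_pow_mul_half_pow_le (by rw [hA]; omega))
    have e3 : ((n * 4 ^ d + 1 : ℕ) : ℝ) * (4 ^ n * (1 / 2) ^ ρ) ≤ (1 / 2) ^ (h + 2) := by
      have := gate_count_le hd2
      calc ((n * 4 ^ d + 1 : ℕ) : ℝ) * (4 ^ n * (1 / 2) ^ ρ)
          ≤ ((2 ^ (3 * n + 3) : ℕ) : ℝ) * (4 ^ n * (1 / 2) ^ ρ) := by gcongr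
        _ = 2 ^ (5 * n + 3) * (1 / 2) ^ ρ := by
            rw [show (4 : ℝ) = 2 ^ 2 by norm_num, ← pow_mul]
            push_cast
            ring
        _ ≤ _ := two_pow_mul_half_pow_le (by rw [hρ]; omega)
    have e4 : (1 / 2 : ℝ) ^ (h + 2) = (1 / 2) ^ h / 4 := by rw [pow_add]; norm_num; ring
    have e5 : (0 : ℝ) ≤ (1 / 2) ^ h := by positivity
    rw [e4] at e1 e2 e3
    linarith
  obtain ⟨w, hw, hw'⟩ := exists_connects_arc hψ hu h0 hd (r := (1 / 2) ^ ρ) (by positivity)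
    (pow_le_one₀ (by norm_num) (by norm_num)) hε0 hstep hs hη (2 ^ A) le_rfl
  rw [hTe] at hw hw'
  refine ⟨_, ?_, w, hw, hw'.trans ?_⟩
  · calc 2 ^ A * (4 ^ n * (n * 4 ^ d + 1)) ≤ 2 ^ A * (4 ^ n * 2 ^ (3 * n + 3)) := by
          gcongr; exact gate_count_le hd2
      _ = 2 ^ logLength n h := by
          rw [logLength, ← hA, show (4 : ℕ) = 2 ^ 2 by norm_num, ← pow_mul]
          ring
  · have : 0 ≤ ((n * 4 ^ d + 1 : ℕ) : ℝ) * (4 ^ n * (1 / 2) ^ ρ) := by positivity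
    linarith

/-! ### Energy along a path -/

section Energy

variable {n : ℕ} {H : Op n}

theorem norm_toEuclideanLin_le_specNorm (H : Op n) (v : Qubits n) :
    ‖Matrix.toEuclideanLin H v‖ ≤ specNorm H * ‖v‖ :=
  (Matrix.toEuclideanCLM (𝕜 := ℂ) H).le_opNorm v

theorem energy_smul (z : ℂ) (v : Qubits n) : energy H (z • v) = ‖z‖ ^ 2 * energy H v := by
  rw [energy, energy, map_smul, inner_smul_left, inner_smul_right, ← mul_assoc, mul_comm _ z,
    Complex.mul_conj, Complex.re_ofReal_mul, Complex.normSq_eq_norm_sq]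

theorem energy_le_add {v w : Qubits n} (hv : ‖v‖ = 1) (hw : ‖w‖ = 1) :
    energy H v ≤ energy H w + 2 * specNorm H * ‖v - w‖ := by
  have h : inner ℂ v (Matrix.toEuclideanLin H v) = inner ℂ w (Matrix.toEuclideanLin H w) +
      inner ℂ (v - w) (Matrix.toEuclideanLin H v) +
      inner ℂ w (Matrix.toEuclideanLin H (v - w)) := by
    rw [map_sub, inner_sub_left, inner_sub_right]
    ring
  have h1 : (inner ℂ (v - w) (Matrix.toEuclideanLin H v)).re ≤ specNorm H * ‖v - w‖ := by
    refine (Complex.re_le_norm _).trans ((norm_inner_le_norm _ _).trans ?_)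
    have := norm_toEuclideanLin_le_specNorm H v
    rw [hv, mul_one] at this
    rw [mul_comm]
    exact mul_le_mul_of_nonneg_right this (norm_nonneg _)
  have h2 : (inner ℂ w (Matrix.toEuclideanLin H (v - w))).re ≤ specNorm H * ‖v - w‖ := by
    refine (Complex.re_le_norm _).trans ((norm_inner_le_norm _ _).trans ?_)
    rw [hw, one_mul]
    exact norm_toEuclideanLin_le_specNorm H _
  rw [energy, energy, h, Complex.add_re, Complex.add_re]
  linarith

/-- The cross term of the quadratic form `energy H v - η ‖v‖²`. -/
noncomputable def crossEnergy (H : Op n) (η : ℝ) (v w : Qubits n) : ℝ :=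
  (inner ℂ v (Matrix.toEuclideanLin H w)).re + (inner ℂ w (Matrix.toEuclideanLin H v)).re
    - 2 * η * (inner ℂ v w).re

theorem energy_sub_combination (η a b : ℝ) (v w : Qubits n) :
    energy H ((a : ℂ) • v + (b : ℂ) • w) - η * ‖(a : ℂ) • v + (b : ℂ) • w‖ ^ 2 =
      a ^ 2 * (energy H v - η * ‖v‖ ^ 2) + b ^ 2 * (energy H w - η * ‖w‖ ^ 2) +
        a * b * crossEnergy H η v w := by
  have h1 : ‖(a : ℂ) • v + (b : ℂ) • w‖ ^ 2 =
      a ^ 2 * ‖v‖ ^ 2 + b ^ 2 * ‖w‖ ^ 2 + 2 * (a * b) * (inner ℂ v w).re := by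
    rw [@norm_add_sq ℂ, norm_smul, norm_smul, inner_smul_left, inner_smul_right, mul_pow, mul_pow,
      Complex.norm_real, Complex.norm_real, Real.norm_eq_abs, Real.norm_eq_abs, sq_abs, sq_abs,
      Complex.conj_ofReal]
    simp only [RCLike.re_to_complex, Complex.re_ofReal_mul]
    ring
  rw [h1, energy, energy, energy, crossEnergy]
  simp only [map_add, map_smul, inner_add_left, inner_add_right, inner_smul_left, inner_smul_right,
    Complex.conj_ofReal, Complex.add_re, Complex.re_ofReal_mul]
  ring

/-- A target state can be multiplied by a phase that makes its overlap with `v` real and the cross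
energy nonpositive: two opposite phases make the overlap real, and the cross energy changes sign
between them. -/
theorem exists_good_phase (H : Op n) (η : ℝ) (v w : Qubits n) :
    ∃ z : ℂ, ‖z‖ = 1 ∧ (inner ℂ v (z • w)).im = 0 ∧ crossEnergy H η v (z • w) ≤ 0 := by
  have h0 : ∃ z : ℂ, ‖z‖ = 1 ∧ (inner ℂ v (z • w)).im = 0 := by
    by_cases h : inner ℂ v w = 0
    · exact ⟨1, norm_one, by rw [inner_smul_right, h, mul_zero, Complex.zero_im]⟩
    · have hn : ‖(inner ℂ v w : ℂ)‖ ≠ 0 := norm_ne_zero_iff.2 h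
      refine ⟨star (inner ℂ v w) / ‖(inner ℂ v w : ℂ)‖, ?_, ?_⟩
      · rw [norm_div, norm_star, Complex.norm_real, norm_norm, div_self hn]
      · rw [inner_smul_right, div_mul_eq_mul_div, Complex.star_def, mul_comm, Complex.mul_conj,
          ← Complex.ofReal_div, Complex.ofReal_im]
  obtain ⟨z, hz, hzi⟩ := h0
  rcases le_total (crossEnergy H η v (z • w)) 0 with h | h
  · exact ⟨z, hz, hzi, h⟩
  · refine ⟨-z, by rwa [norm_neg], ?_, ?_⟩
    · rw [neg_smul, inner_neg_right, Complex.neg_im, hzi, neg_zero]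
    · have : crossEnergy H η v (-z • w) = -crossEnergy H η v (z • w) := by
        simp only [crossEnergy, neg_smul, map_neg, inner_neg_right, inner_neg_left, Complex.neg_re]
        ring
      rw [this]
      linarith

end Energy

/-! ### Connecting low-energy states -/

section LowEnergy

variable {n : ℕ} {H : Op n}

/-- On the arc from `ψ` to `φ` the states are nonnegative real combinations of `ψ` and `φ`, and all
three coefficients of the form `energy H v - η ‖v‖²` are nonpositive. -/
theorem energy_arc_le {ψ φ : Qubits n} (hψ : ‖ψ‖ = 1) (hφ : ‖φ‖ = 1) {η κ : ℝ}
    (hEψ : energy H ψ ≤ η) (hEφ : energy H φ ≤ η) (hcross : crossEnergy H η ψ φ ≤ 0)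
    {u : Qubits n} (hu : ‖u‖ = 1) (hψu : inner ℂ ψ u = 0) (hκ : 0 < Real.sin κ)
    (huφ : arc ψ u κ = φ) {θ : ℝ} (hθ : 0 ≤ θ) (hθκ : θ ≤ κ) (hκπ : κ ≤ Real.pi) :
    energy H (arc ψ u θ) ≤ η := by
  have hs : (Real.sin κ : ℂ) ≠ 0 := by exact_mod_cast hκ.ne'
  have e : arc ψ u θ = ((Real.sin (κ - θ) / Real.sin κ : ℝ) : ℂ) • ψ +
      ((Real.sin θ / Real.sin κ : ℝ) : ℂ) • φ := by
    rw [← huφ, arc, arc, Real.sin_sub]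
    push_cast at hs ⊢
    match_scalars <;> field_simp
    ring
  have h1 := energy_sub_combination (H := H) η (Real.sin (κ - θ) / Real.sin κ)
    (Real.sin θ / Real.sin κ) ψ φ
  rw [← e, norm_arc hψ hu hψu, hψ, hφ] at h1
  have h2 : 0 ≤ Real.sin (κ - θ) / Real.sin κ :=
    div_nonneg (Real.sin_nonneg_of_nonneg_of_le_pi (by linarith) (by linarith)) hκ.le
  have h3 : 0 ≤ Real.sin θ / Real.sin κ :=
    div_nonneg (Real.sin_nonneg_of_nonneg_of_le_pi hθ (by linarith)) hκ.le
  have h4 := mul_nonneg (sq_nonneg (Real.sin (κ - θ) / Real.sin κ)) (sub_nonneg.2 hEψ)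
  have h5 := mul_nonneg (sq_nonneg (Real.sin θ / Real.sin κ)) (sub_nonneg.2 hEφ)
  have h6 := mul_nonneg (mul_nonneg h2 h3) (sub_nonneg.2 hcross)
  nlinarith

/-- Unit vectors with real overlap are multiples of each other or lie on a great circle spanned by
*complex*-orthogonal vectors. -/
theorem eq_smul_or_exists_arc {ψ φ : Qubits n} (hψ : ‖ψ‖ = 1) (hφ : ‖φ‖ = 1)
    (him : (inner ℂ ψ φ).im = 0) :
    (∃ z : ℂ, ‖z‖ = 1 ∧ φ = z • ψ) ∨
      ∃ (u : Qubits n) (κ : ℝ), ‖u‖ = 1 ∧ inner ℂ ψ u = 0 ∧ 0 < Real.sin κ ∧ 0 ≤ κ ∧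
        κ ≤ Real.pi ∧ arc ψ u κ = φ := by
  obtain ⟨c, hc⟩ : ∃ c : ℝ, inner ℂ ψ φ = (c : ℂ) :=
    ⟨(inner ℂ ψ φ).re, Complex.ext (by simp) (by simpa using him)⟩
  have hψψ : inner ℂ ψ ψ = (1 : ℂ) := by rw [inner_self_eq_norm_sq_to_K, hψ]; simp
  have hort : inner ℂ ψ (φ - (c : ℂ) • ψ) = 0 := by
    rw [inner_sub_right, inner_smul_right, hc, hψψ, mul_one, sub_self]
  have hnorm : ‖φ - (c : ℂ) • ψ‖ ^ 2 = 1 - c ^ 2 := by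
    have h1 : φ = (φ - (c : ℂ) • ψ) + (c : ℂ) • ψ := by abel
    have h2 := norm_add_sq_eq_norm_sq_add_norm_sq_of_inner_eq_zero (𝕜 := ℂ) (φ - (c : ℂ) • ψ)
      ((c : ℂ) • ψ) (by rw [inner_smul_right, inner_eq_zero_symm.1 hort, mul_zero])
    rw [← h1, hφ, norm_smul, hψ, Complex.norm_real, Real.norm_eq_abs, mul_one, mul_one,
      abs_mul_abs_self] at h2
    nlinarith
  by_cases h : φ - (c : ℂ) • ψ = 0
  · left
    rw [h, norm_zero] at hnorm
    refine ⟨c, ?_, sub_eq_zero.1 h⟩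
    rw [Complex.norm_real, Real.norm_eq_abs, ← sq_eq_sq₀ (abs_nonneg _) zero_le_one, sq_abs]
    linarith
  · right
    have hpos : 0 < ‖φ - (c : ℂ) • ψ‖ := norm_pos_iff.2 h
    have hc2 : c ^ 2 ≤ 1 := by nlinarith
    have hc1 : -1 ≤ c ∧ c ≤ 1 := abs_le.1 ((sq_le_one_iff_abs_le_one c).1 hc2)
    have hsin : Real.sin (Real.arccos c) = ‖φ - (c : ℂ) • ψ‖ := by
      rw [Real.sin_arccos, ← hnorm, Real.sqrt_sq (norm_nonneg _)]
    have hne : (‖φ - (c : ℂ) • ψ‖ : ℂ) ≠ 0 := by exact_mod_cast hpos.ne'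
    refine ⟨((‖φ - (c : ℂ) • ψ‖ : ℂ))⁻¹ • (φ - (c : ℂ) • ψ), Real.arccos c, ?_, ?_, ?_,
      Real.arccos_nonneg c, Real.arccos_le_pi c, ?_⟩
    · rw [norm_smul, norm_inv, Complex.norm_real, norm_norm, inv_mul_cancel₀ hpos.ne']
    · rw [inner_smul_right, hort, mul_zero]
    · rwa [hsin]
    · rw [arc, hsin, Real.cos_arccos hc1.1 hc1.2, smul_smul, mul_inv_cancel₀ hne, one_smul]
      abel

theorem Connects.mem_right {good : Set (Qubits n)} {L : ℕ} {v w : Qubits n}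
    (h : Connects good L v w) : w ∈ good := by
  obtain ⟨Us, rfl, -, rfl, h4⟩ := h
  simpa using h4 Us.length le_rfl

theorem Connects.inter_norm_eq {good : Set (Qubits n)} {L : ℕ} {v w : Qubits n}
    (h : Connects good L v w) : Connects (good ∩ {x | ‖x‖ = ‖v‖}) L v w := by
  obtain ⟨Us, rfl, h2, rfl, h4⟩ := h
  exact ⟨Us, rfl, h2, rfl, fun i hi =>
    ⟨h4 i hi, norm_run (fun U hU => (h2 U (List.mem_of_mem_take hU)).1) v⟩⟩

/-- A global phase is a single gate. -/
theorem connects_smul {good : Set (Qubits n)} {z : ℂ} (hz : ‖z‖ = 1) {v : Qubits n}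
    (hv : v ∈ good) (hzv : z • v ∈ good) : Connects good 1 v (z • v) := by
  have h : Matrix.toEuclideanLin (z • (1 : Op n)) v = z • v := by
    rw [map_smul, LinearMap.smul_apply, toEuclideanLin_one_apply]
  refine ⟨[z • 1], rfl, fun U hU => ?_, h, fun i hi => ?_⟩
  · rw [List.mem_singleton.1 hU]
    exact ⟨smul_one_mem_unitaryGroup hz, isLocal_smul_one 2 z⟩
  · interval_cases i
    · exact hv
    · simpa [h] using hzv

/-- Any two states of energy at most `η` are connected, up to an exponentially small distance, by
exponentially many two-local unitaries through states whose energy exceeds `η` by an exponentially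
small amount. -/
theorem exists_connects_low_energy (hn : 1 ≤ n) {ψ φ : Qubits n} (hψ : ‖ψ‖ = 1) (hφ : ‖φ‖ = 1)
    {η : ℝ} (hEψ : energy H ψ ≤ η) (hEφ : energy H φ ≤ η) {Q : ℕ} (hH : specNorm H ≤ 2 ^ Q) :
    ∃ L ≤ 2 ^ (logLength n (Q + n + 2) + 1), ∃ w,
      Connects {v | energy H v < η + (1 / 2) ^ n} L ψ w ∧ ‖w - φ‖ < (1 / 2) ^ n := by
  have hpow : (0 : ℝ) < (1 / 2) ^ n := by positivity
  obtain ⟨z, hz, him, hcross⟩ := exists_good_phase H η ψ φ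
  have hzz : star z * z = 1 := by
    rw [Complex.star_def, Complex.conj_mul', hz]; simp
  have hzφ : ‖z • φ‖ = 1 := by rw [norm_smul, hz, hφ, mul_one]
  have hEzφ : energy H (z • φ) ≤ η := by rw [energy_smul, hz]; linarith
  have hψgood : energy H ψ < η + (1 / 2) ^ n := by linarith
  rcases eq_smul_or_exists_arc hψ hzφ him with ⟨y, hy, h⟩ | ⟨u, κ, hu, hψu, hκ, hκ0, hκπ, h⟩
  · have e : φ = (star z * y) • ψ := by
      rw [mul_smul, ← h, smul_smul, hzz, one_smul]
    refine ⟨1, Nat.one_le_two_pow, φ, ?_, by rwa [sub_self, norm_zero]⟩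
    have hn1 : ‖star z * y‖ = 1 := by rw [norm_mul, norm_star, hz, hy, mul_one]
    have h2 : energy H ((star z * y) • ψ) < η + (1 / 2) ^ n := by
      rw [energy_smul, hn1]; linarith
    rw [e]
    exact connects_smul hn1 hψgood h2
  · obtain ⟨L, hL, w, hw, hwd⟩ := exists_connects_arc_end hn hψ hu hψu hκ0
      (hκπ.trans Real.pi_le_four) (Q + n + 2)
    have hsmall : (1 / 2 : ℝ) ^ (Q + n + 2) < (1 / 2) ^ n :=
      pow_lt_pow_right_of_lt_one₀ (by norm_num) (by norm_num) (by omega)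
    have hsmall' : 2 * (2 : ℝ) ^ Q * (1 / 2) ^ (Q + n + 2) < (1 / 2) ^ n := by
      have : (2 : ℝ) ^ Q * (1 / 2) ^ Q = 1 := by rw [← mul_pow]; norm_num
      calc 2 * (2 : ℝ) ^ Q * (1 / 2) ^ (Q + n + 2)
          = (2 ^ Q * (1 / 2) ^ Q) * (1 / 2) ^ n * (1 / 2) := by ring
        _ < _ := by rw [this]; linarith
    have hw2 : Connects {v | energy H v < η + (1 / 2) ^ n} L ψ w := by
      refine hw.inter_norm_eq.mono ?_
      rintro v ⟨⟨θ, hθ, hθκ, hv⟩, hv1⟩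
      have hv1 : ‖v‖ = 1 := hv1.trans hψ
      have h1 := energy_le_add (H := H) hv1 (norm_arc hψ hu hψu θ)
      have h2 := energy_arc_le hψ hzφ hEψ hEzφ hcross hu hψu hκ h hθ hθκ hκπ
      have h3 : 2 * specNorm H * ‖v - arc ψ u θ‖ ≤ 2 * 2 ^ Q * (1 / 2) ^ (Q + n + 2) :=
        mul_le_mul (by linarith) hv (norm_nonneg _) (by positivity)
      change energy H v < η + (1 / 2) ^ n
      linarith
    rw [h] at hwd
    have hsz : ‖star z‖ = 1 := by rw [norm_star, hz]
    refine ⟨L + 1, ?_, star z • w, hw2.trans (connects_smul hsz hw2.mem_right ?_), ?_⟩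
    · have := Nat.one_le_two_pow (n := logLength n (Q + n + 2))
      rw [pow_succ]
      omega
    · have h2 := hw2.mem_right
      change energy H (star z • w) < _
      change energy H w < _ at h2
      rw [energy_smul, hsz]
      linarith
    · have e : star z • w - φ = star z • (w - z • φ) := by
        rw [smul_sub, smul_smul, hzz, one_smul]
      rw [e, norm_smul, hsz, one_mul]
      linarith

end LowEnergy

/-! ### Instances of ground state connectivity -/

theorem norm_circuit_state {G : GateSet} {n : ℕ} (C : Circuit G n) : ‖Circuit.state C‖ = 1 := by
  rw [Circuit.state, norm_run]
  · rw [zeroState, PiLp.norm_single, norm_one]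
  · intro U hU
    obtain ⟨g, -, rfl⟩ := List.mem_map.1 hU
    exact embed_mem_unitaryGroup _ (G.unitary _)

theorem Instance.not_isNo {G : GateSet} {n : ℕ} (hn : 1 ≤ n) {x : Instance G n} (hx : x.Valid)
    (hl : x.l = 2) {Q : ℕ} (hH : specNorm x.H ≤ 2 ^ Q) (hΔ : (1 / 2) ^ n ≤ x.Δ)
    (hm : 2 ^ (logLength n (Q + n + 2) + 1) ≤ x.m) : ¬ x.IsNo := by
  intro hno
  obtain ⟨L, hL, w, hw, hwd⟩ := exists_connects_low_energy hn (norm_circuit_state x.startCircuit)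
    (norm_circuit_state x.targetCircuit) hx.energy_start hx.energy_target hH
  obtain ⟨Us, h1, h2, h3, h4⟩ := hw.trans (Connects.wait hw.mem_right (x.m - L))
  rw [Nat.add_sub_cancel' (hL.trans hm)] at h1 h4
  rcases hno Us ⟨h1, fun U hU => hl ▸ h2 U hU⟩ with ⟨i, hi, hE⟩ | hd
  · have h5 : energy x.H (x.intermediate Us i) < x.η₁ + (1 / 2) ^ n := h4 i (Finset.mem_Icc.1 hi).2
    linarith [hx.energy_gap]
  · have h6 : x.intermediate Us x.m = w := by
      rw [Instance.intermediate, ← h1, List.take_length]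
      exact h3
    rw [h6] at hd
    have h7 : ‖w - x.φ‖ < (1 / 2) ^ n := hwd
    linarith [hx.distance_gap, hx.distance_nonneg]

theorem Instance.not_isNo_of_isYes {G : GateSet} {n : ℕ} {x : Instance G n} (hx : x.Valid)
    (hΔ : 0 < x.Δ) (hyes : x.IsYes) : ¬ x.IsNo := by
  intro hno
  obtain ⟨Us, h1, h2, h3⟩ := hyes
  rcases hno Us h1 with ⟨i, hi, hE⟩ | hd
  · linarith [h2 i hi, hx.energy_gap]
  · linarith [hx.distance_gap]

theorem Subexponential.pos {δ : ℕ → ℝ} (h : Subexponential δ) (n : ℕ) : 0 < δ n := by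
  obtain ⟨f, -, hf⟩ := h
  rw [hf]
  positivity

theorem Subexponential.eventually_ge {δ : ℕ → ℝ} (h : Subexponential δ) :
    ∀ᶠ n : ℕ in atTop, (1 / 2 : ℝ) ^ n ≤ δ n := by
  obtain ⟨f, hf, hδ⟩ := h
  filter_upwards [hf.bound one_pos] with n hn
  rw [hδ, one_div, inv_pow, ← Real.rpow_natCast, ← Real.rpow_neg (by norm_num)]
  refine Real.rpow_le_rpow_of_exponent_le (by norm_num) ?_
  rw [one_mul, Real.norm_natCast] at hn
  linarith [(abs_le.1 hn).2]

theorem exists_polynomial_logLength (q : Polynomial ℕ) :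
    ∃ p : Polynomial ℕ, ∀ n, p.eval n = logLength n (q.eval n + n + 2) + 1 := by
  refine ⟨(q + .X + 2) + 9 + 12 * .X + ((q + .X + 2) + 5 * .X + 9) * (2 * .X) + 5 * .X + 3 + 1,
    fun n => ?_⟩
  simp [logLength]

end GSCON

theorem mainTheorem6 :
    ∀ q : Polynomial ℕ, ∃ p : Polynomial ℕ, ∀ δ : ℕ → ℝ, GSCON.Subexponential δ →
      (∃ n₀ : ℕ, ∀ n ≥ n₀, ∀ (G : GSCON.GateSet) (x : GSCON.Instance G n),
        x.Valid → x.l = 2 → GSCON.specNorm x.H ≤ (2 : ℝ) ^ q.eval n → δ n ≤ x.Δ →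
          2 ^ p.eval n ≤ x.m → ¬ x.IsNo) ∧
      (∀ (G : GSCON.GateSet) (s r : Polynomial ℕ) (Γ : Type) [Fintype Γ]
        (e : Computability.Encoding (GSCON.Input G) Γ),
        GSCON.PromiseInP
          (e.encode '' {x | x.InRegime s q p r δ ∧ x.toInstance.IsYes})
          (e.encode '' {x | x.InRegime s q p r δ ∧ x.toInstance.IsNo})) := by
  intro q
  obtain ⟨p, hp⟩ := GSCON.exists_polynomial_logLength q
  refine ⟨p, fun δ hδ => ?_⟩
  have no_large : ∃ n₀ : ℕ, ∀ n ≥ n₀, ∀ (G : GSCON.GateSet) (x : GSCON.Instance G n),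
      x.Valid → x.l = 2 → GSCON.specNorm x.H ≤ (2 : ℝ) ^ q.eval n → δ n ≤ x.Δ →
        2 ^ p.eval n ≤ x.m → ¬ x.IsNo := by
    obtain ⟨n₀, hn₀⟩ := eventually_atTop.1 hδ.eventually_ge
    refine ⟨max n₀ 1, fun n hn G x hx hl hH hΔ hm => ?_⟩
    rw [hp] at hm
    exact x.not_isNo (le_of_max_le_right hn) hx hl hH ((hn₀ n (le_of_max_le_left hn)).trans hΔ) hm
  refine ⟨no_large, fun G s r Γ _ e => ?_⟩
  obtain ⟨n₀, hn₀⟩ := no_large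
  refine GSCON.promiseInP_of_finite (Set.Finite.image _ ?_) ?_
  · -- A NO-instance has fewer than `n₀` qubits, so its size is bounded.
    obtain ⟨B, hB⟩ := ((Set.finite_Iio n₀).image fun n => s.eval n).bddAbove
    obtain ⟨M, hM⟩ := ((Set.finite_Iio n₀).image fun n => 2 ^ r.eval n).bddAbove
    refine (GSCON.finite_input_size_le G n₀ B M).subset ?_
    rintro x ⟨hx, hno⟩
    have hlt : x.n < n₀ := by
      by_contra hge
      exact hn₀ x.n (not_lt.1 hge) G x.toInstance hx.valid.2 hx.two_local hx.norm_le hx.gap_ge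
        hx.le_length hno
    exact ⟨hlt, hx.size_le.trans (hB ⟨x.n, hlt, rfl⟩), hx.two_local,
      hx.length_le.trans (hM ⟨x.n, hlt, rfl⟩)⟩
  · rw [Set.disjoint_image_iff e.encode_injective, Set.disjoint_left]
    rintro x ⟨hx, hyes⟩ ⟨-, hno⟩
    have hΔ : (0 : ℝ) < x.toInstance.Δ := (hδ.pos x.n).trans_le hx.gap_ge
    exact x.toInstance.not_isNo_of_isYes hx.valid.2 hΔ hyes hno
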